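/- Let $n\ge 0$ and let $\mathcal K^\infty$ be the algebra of integral operators $(Sf)(x)=\int_{\mathbb R^n}k(x,y)f(y)\,dy$ on $L^2(\mathbb R^n)$ with Schwartz kernels $k\in\mathcal S(\mathbb R^n\times\mathbb R^n)$. Let $\delta_1,\dots,\delta_{2n}:\mathcal K^\infty\to\mathcal K^\infty$ be the derivations $\delta_{2j-1}(S)=[\partial_{x_j},S]$ and $\delta_{2j}(S)=[x_j,S]$ for $1\le j\le n$, and let $\mathrm{Tr}$ be the canonical operator trace. Define $$\omega(T_0,\dots,T_{2n})=\frac{(-1)^n}{n!}\sum_{\sigma\in S_{2n}}\mathrm{sgn}(\sigma)\,\mathrm{Tr}\bigl(T_0\,\delta_{\sigma(1)}(T_1)\cdots\delta_{\sigma(2n)}(T_{2n})\bigr),\qquad T_0,\dots,T_{2n}\in\mathcal K^\infty .$$ For a cyclic $2l$-cocycle $\phi$ on an algebra $A$ and an idempotent $e\in M_k(A)$ put $$\langle[e],[\phi]\rangle=(2\pi i)^{-l}(l!)^{-1}(\phi\#\mathrm{tr})(e,\dots,e),$$ where $$(\phi\#\mathrm{tr})(M_0,\dots,M_{2l})=\sum_{i_0,\dots,i_{2l}}\phi\bigl((M_0)_{i_0i_1},(M_1)_{i_1i_2},\dots,(M_{2l})_{i_{2l}i_0}\bigr).$$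 Then all traces in the definition of $\omega$ exist, $\omega$ is a cyclic $2n$-cocycle on $\mathcal K^\infty$, and every idempotent $T\in\mathcal K^\infty$ is of trace class with $$\langle[T],[(2\pi i)^n\,n!\,\omega]\rangle=\mathrm{Tr}(T).$$ Here the left-hand side may be computed from any cyclic $2n$-cocycle $\phi$ on $\mathcal K^\infty$ with the same class as $(2\pi i)^n\,n!\,\omega$ in the cyclic cohomology group $HC^{2n}(\mathcal K^\infty)$ and any idempotent matrix $e$ over $\mathcal K^\infty$ with the same class as $T$ in $K_0(\mathcal K^\infty)$. -/

import Mathlib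

open MeasureTheory
open scoped SchwartzMap LineDeriv ContDiff InnerProductSpace

set_option linter.unusedSectionVars false

namespace SmoothingOps

section PartialIntegral

variable {W Z V : Type} [NormedAddCommGroup W] [NormedSpace ℝ W]
  [NormedAddCommGroup Z] [NormedSpace ℝ Z] [NormedAddCommGroup V] [NormedSpace ℝ V]

lemma schwartz_prod_decay (F : 𝓢(W × Z, V)) (r : ℕ) : ∃ C : ℝ, 0 ≤ C ∧ ∀ w z,
    ‖F (w, z)‖ ≤ C * (1 + ‖w‖) ^ (-(r : ℝ)) * (1 + ‖z‖) ^ (-(r : ℝ)) := by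
  obtain ⟨C, hC⟩ : ∃ C : ℝ, ∀ p, (1 + ‖p‖) ^ (2 * r) * ‖F p‖ ≤ C := by
    refine ⟨2 ^ (2 * r) * (Finset.Iic (2 * r, 0)).sup
      (fun m => SchwartzMap.seminorm ℝ m.1 m.2) F, fun p => ?_⟩
    have := SchwartzMap.one_add_le_sup_seminorm_apply (𝕜 := ℝ) (m := (2 * r, 0)) (k := 2 * r)
      (n := 0) le_rfl le_rfl F p
    rw [norm_iteratedFDeriv_zero] at this
    exact this
  refine ⟨C, le_trans (by positivity) (hC 0), fun w z => ?_⟩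
  have h1 : (0 : ℝ) < 1 + ‖w‖ := by positivity
  have h2 : (0 : ℝ) < 1 + ‖z‖ := by positivity
  rw [Real.rpow_neg h1.le, Real.rpow_neg h2.le, Real.rpow_natCast, Real.rpow_natCast,
    mul_assoc, ← mul_inv, ← div_eq_mul_inv, le_div_iff₀ (by positivity), mul_comm]
  refine le_trans ?_ (hC (w, z))
  rw [two_mul, pow_add]
  have h3 : ‖w‖ ≤ ‖(w, z)‖ := norm_fst_le (w, z)
  have h4 : ‖z‖ ≤ ‖(w, z)‖ := norm_snd_le (w, z)
  gcongr

variable [MeasurableSpace Z] [BorelSpace Z] [FiniteDimensional ℝ Z]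
  (μ : Measure Z) [μ.IsAddHaarMeasure]

lemma integrable_weight : Integrable (fun z : Z =>
    (1 + ‖z‖) ^ (-((Module.finrank ℝ Z + 1 : ℕ) : ℝ))) μ :=
  integrable_one_add_norm (by push_cast; linarith)

lemma weight_le_one {Y : Type} [NormedAddCommGroup Y] (r : ℕ) (w : Y) :
    (1 + ‖w‖) ^ (-(r : ℝ)) ≤ 1 :=
  Real.rpow_le_one_of_one_le_of_nonpos (by linarith [norm_nonneg w]) (by simp)

lemma schwartz_slice_bound (F : 𝓢(W × Z, V)) : ∃ C : ℝ, ∀ w z, ‖F (w, z)‖ ≤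
    C * (1 + ‖z‖) ^ (-((Module.finrank ℝ Z + 1 : ℕ) : ℝ)) := by
  obtain ⟨C, hC0, hC⟩ := schwartz_prod_decay F (Module.finrank ℝ Z + 1)
  refine ⟨C, fun w z => (hC w z).trans ?_⟩
  gcongr
  exact mul_le_of_le_one_right hC0 (weight_le_one _ w)

lemma integrable_schwartz_slice (F : 𝓢(W × Z, V)) (w : W) :
    Integrable (fun z => F (w, z)) μ := by
  obtain ⟨C, hC⟩ := schwartz_slice_bound F
  refine ((integrable_weight μ).const_mul C).mono' ?_ (Filter.Eventually.of_forall (hC w))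
  exact (F.continuous.comp (by fun_prop)).aestronglyMeasurable

/-- Derivative of a Schwartz function in the first variable. -/
noncomputable def partialFDeriv (F : 𝓢(W × Z, V)) : 𝓢(W × Z, W →L[ℝ] V) :=
  SchwartzMap.postcompCLM ((ContinuousLinearMap.compL ℝ W (W × Z) V).flip
    (ContinuousLinearMap.inl ℝ W Z)) (SchwartzMap.fderivCLM ℝ (W × Z) V F)

lemma partialFDeriv_apply (F : 𝓢(W × Z, V)) (p : W × Z) (v : W) :
    partialFDeriv F p v = fderiv ℝ F p (v, 0) := by
  simp [partialFDeriv]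

lemma hasFDerivAt_partial (F : 𝓢(W × Z, V)) (w : W) (z : Z) :
    HasFDerivAt (fun w => F (w, z)) (partialFDeriv F (w, z)) w := by
  have h : HasFDerivAt (fun w => F (w, z)) _ w :=
    HasFDerivAt.comp (f := fun e => (e, z)) w (F.hasFDerivAt (w, z)) (hasFDerivAt_prodMk_left w z)
  exact h

lemma hasFDerivAt_partialIntegral (F : 𝓢(W × Z, V)) (w : W) :
    HasFDerivAt (fun w => ∫ z, F (w, z) ∂μ) (∫ z, partialFDeriv F (w, z) ∂μ) w := by
  obtain ⟨C, hC⟩ := schwartz_slice_bound (partialFDeriv F)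
  exact hasFDerivAt_integral_of_dominated_of_fderiv_le (s := Set.univ) Filter.univ_mem
    (Filter.Eventually.of_forall fun w => (integrable_schwartz_slice μ F w).aestronglyMeasurable)
    (integrable_schwartz_slice μ F w)
    (integrable_schwartz_slice μ (partialFDeriv F) w).aestronglyMeasurable
    (Filter.Eventually.of_forall fun z w _ => hC w z) ((integrable_weight μ).const_mul C)
    (Filter.Eventually.of_forall fun z w _ => hasFDerivAt_partial F w z)

lemma contDiff_partialIntegral (n : ℕ) : ∀ {V : Type} [NormedAddCommGroup V] [NormedSpace ℝ V]
    (F : 𝓢(W × Z, V)), ContDiff ℝ n (fun w => ∫ z, F (w, z) ∂μ) := by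
  induction n with
  | zero =>
    intro V _ _ F
    exact contDiff_zero.2 (continuous_iff_continuousAt.2 fun w =>
      (hasFDerivAt_partialIntegral μ F w).continuousAt)
  | succ n ih =>
    intro V _ _ F
    refine contDiff_succ_iff_hasFDerivAt.2 ⟨_, ih (partialFDeriv F), fun w =>
      hasFDerivAt_partialIntegral μ F w⟩

lemma decay_partialIntegral (k n : ℕ) : ∀ {V : Type} [NormedAddCommGroup V] [NormedSpace ℝ V]
    (F : 𝓢(W × Z, V)), ∃ C : ℝ, ∀ w,
      ‖w‖ ^ k * ‖iteratedFDeriv ℝ n (fun w => ∫ z, F (w, z) ∂μ) w‖ ≤ C := by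
  induction n with
  | zero =>
    intro V _ _ F
    obtain ⟨C, hC0, hC⟩ := schwartz_prod_decay F (k + (Module.finrank ℝ Z + 1))
    refine ⟨∫ z, C * (1 + ‖z‖) ^ (-((Module.finrank ℝ Z + 1 : ℕ) : ℝ)) ∂μ, fun w => ?_⟩
    rw [norm_iteratedFDeriv_zero]
    have h1 : ∀ z, ‖w‖ ^ k * ‖F (w, z)‖ ≤
        C * (1 + ‖z‖) ^ (-((Module.finrank ℝ Z + 1 : ℕ) : ℝ)) := by
      intro z
      have hz : (1 + ‖z‖) ^ (-((k + (Module.finrank ℝ Z + 1) : ℕ) : ℝ)) ≤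
          (1 + ‖z‖) ^ (-((Module.finrank ℝ Z + 1 : ℕ) : ℝ)) := by
        apply Real.rpow_le_rpow_of_exponent_le (by linarith [norm_nonneg z])
        push_cast
        linarith [(Nat.cast_nonneg k : (0 : ℝ) ≤ k)]
      have hw : ‖w‖ ^ k * (1 + ‖w‖) ^ (-((k + (Module.finrank ℝ Z + 1) : ℕ) : ℝ)) ≤ 1 := by
        have h0 : (0 : ℝ) < 1 + ‖w‖ := by positivity
        rw [Real.rpow_neg h0.le, Real.rpow_natCast, ← div_eq_mul_inv, div_le_one (by positivity),
          pow_add]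
        calc ‖w‖ ^ k ≤ (1 + ‖w‖) ^ k := by gcongr; linarith
          _ ≤ (1 + ‖w‖) ^ k * (1 + ‖w‖) ^ (Module.finrank ℝ Z + 1) :=
            le_mul_of_one_le_right (by positivity) (one_le_pow₀ (by linarith [norm_nonneg w]))
      calc ‖w‖ ^ k * ‖F (w, z)‖ ≤ ‖w‖ ^ k * (C * (1 + ‖w‖) ^
            (-((k + (Module.finrank ℝ Z + 1) : ℕ) : ℝ)) *
            (1 + ‖z‖) ^ (-((k + (Module.finrank ℝ Z + 1) : ℕ) : ℝ))) := by
            gcongr; exact hC w z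
        _ = C * (‖w‖ ^ k * (1 + ‖w‖) ^ (-((k + (Module.finrank ℝ Z + 1) : ℕ) : ℝ))) *
            (1 + ‖z‖) ^ (-((k + (Module.finrank ℝ Z + 1) : ℕ) : ℝ)) := by ring
        _ ≤ C * 1 * (1 + ‖z‖) ^ (-((Module.finrank ℝ Z + 1 : ℕ) : ℝ)) := by gcongr
        _ = _ := by ring
    calc ‖w‖ ^ k * ‖∫ z, F (w, z) ∂μ‖ ≤ ‖w‖ ^ k * ∫ z, ‖F (w, z)‖ ∂μ := by
          gcongr; exact norm_integral_le_integral_norm _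
      _ = ∫ z, ‖w‖ ^ k * ‖F (w, z)‖ ∂μ := (integral_const_mul _ _).symm
      _ ≤ _ := integral_mono ((integrable_schwartz_slice μ F w).norm.const_mul _)
          ((integrable_weight μ).const_mul C) h1
  | succ n ih =>
    intro V _ _ F
    obtain ⟨C, hC⟩ := ih (partialFDeriv F)
    refine ⟨C, fun w => ?_⟩
    rw [← norm_iteratedFDeriv_fderiv]
    have : fderiv ℝ (fun w => ∫ z, F (w, z) ∂μ) = fun w => ∫ z, partialFDeriv F (w, z) ∂μ :=
      funext fun w => (hasFDerivAt_partialIntegral μ F w).fderiv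
    rw [this]
    exact hC w

/-- Integrating out one variable maps Schwartz functions to Schwartz functions. -/
noncomputable def partialIntegral (F : 𝓢(W × Z, V)) : 𝓢(W, V) where
  toFun w := ∫ z, F (w, z) ∂μ
  smooth' := contDiff_infty.2 fun n => contDiff_partialIntegral μ n F
  decay' k n := decay_partialIntegral μ k n F

end PartialIntegral

section Product

variable {D D₁ D₂ : Type} [NormedAddCommGroup D] [NormedSpace ℝ D]
  [NormedAddCommGroup D₁] [NormedSpace ℝ D₁] [NormedAddCommGroup D₂] [NormedSpace ℝ D₂]

lemma iteratedFDeriv_comp_bound (A : D →L[ℝ] D₁) (f : 𝓢(D₁, ℂ)) (k i : ℕ) :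
    ∃ C : ℝ, 0 ≤ C ∧ ∀ w, ‖A w‖ ^ k * ‖iteratedFDeriv ℝ i (fun w => f (A w)) w‖ ≤ C := by
  obtain ⟨C, hC0, hC⟩ := f.decay k i
  refine ⟨C * ‖A‖ ^ i, by positivity, fun w => ?_⟩
  have h : iteratedFDeriv ℝ i (fun w => f (A w)) w =
      (iteratedFDeriv ℝ i f (A w)).compContinuousLinearMap fun _ => A :=
    A.iteratedFDeriv_comp_right (f.smooth i) w le_rfl
  rw [h]
  calc _ ≤ ‖A w‖ ^ k * (‖iteratedFDeriv ℝ i f (A w)‖ * ∏ _j : Fin i, ‖A‖) := by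
        gcongr; exact ContinuousMultilinearMap.norm_compContinuousLinearMap_le _ _
    _ = (‖A w‖ ^ k * ‖iteratedFDeriv ℝ i f (A w)‖) * ‖A‖ ^ i := by simp; ring
    _ ≤ _ := by gcongr; exact hC _

/-- `w ↦ f (A w) * g (B w)` for Schwartz functions `f`, `g` and linear maps `A`, `B` that together
control the norm of `w`. -/
noncomputable def productMap (A : D →L[ℝ] D₁) (B : D →L[ℝ] D₂)
    (h : ∀ w, ‖w‖ ≤ max ‖A w‖ ‖B w‖) (f : 𝓢(D₁, ℂ)) (g : 𝓢(D₂, ℂ)) : 𝓢(D, ℂ) where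
  toFun w := f (A w) * g (B w)
  smooth' := ((f.smooth ⊤).comp A.contDiff).mul ((g.smooth ⊤).comp B.contDiff)
  decay' k n := by
    choose Cf hCf0 hCf using iteratedFDeriv_comp_bound A f
    choose Cg hCg0 hCg using iteratedFDeriv_comp_bound B g
    refine ⟨∑ i ∈ Finset.range (n + 1), (n.choose i : ℝ) *
      (Cf k i * Cg 0 (n - i) + Cf 0 i * Cg k (n - i)), fun w => ?_⟩
    have hf : ContDiff ℝ ∞ fun w => f (A w) := (f.smooth ⊤).comp A.contDiff
    have hg : ContDiff ℝ ∞ fun w => g (B w) := (g.smooth ⊤).comp B.contDiff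
    have key := norm_iteratedFDeriv_mul_le (n := n) hf hg w (mod_cast le_top)
    refine (mul_le_mul_of_nonneg_left key (by positivity)).trans ?_
    rw [Finset.mul_sum]
    refine Finset.sum_le_sum fun i hi => ?_
    have hw : ‖w‖ ^ k ≤ ‖A w‖ ^ k + ‖B w‖ ^ k := by
      rcases le_max_iff.1 (h w) with h | h
      · exact (pow_le_pow_left₀ (norm_nonneg _) h k).trans (le_add_of_nonneg_right (by positivity))
      · exact (pow_le_pow_left₀ (norm_nonneg _) h k).trans (le_add_of_nonneg_left (by positivity))
    set a := ‖iteratedFDeriv ℝ i (fun w => f (A w)) w‖ with ha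
    set b := ‖iteratedFDeriv ℝ (n - i) (fun w => g (B w)) w‖ with hb
    have e1 := hCf k i w
    have e2 := hCf 0 i w
    have e3 := hCg k (n - i) w
    have e4 := hCg 0 (n - i) w
    rw [pow_zero, one_mul] at e2 e4
    have ha0 : 0 ≤ a := norm_nonneg _
    have hb0 : 0 ≤ b := norm_nonneg _
    calc ‖w‖ ^ k * ((n.choose i : ℝ) * a * b)
        ≤ (‖A w‖ ^ k + ‖B w‖ ^ k) * ((n.choose i : ℝ) * a * b) := by gcongr
      _ = (n.choose i : ℝ) * ((‖A w‖ ^ k * a) * b + a * (‖B w‖ ^ k * b)) := by ring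
      _ ≤ _ := by
        gcongr
        · exact hCf0 k i
        · exact hCf0 0 i

end Product


section Operators

/-- Euclidean space `ℝⁿ`. -/
abbrev Rn (n : ℕ) : Type := EuclideanSpace ℝ (Fin n)

/-- The Hilbert space `L²(ℝⁿ)` of complex square-integrable functions (Lebesgue measure). -/
abbrev L2 (n : ℕ) : Type := Lp ℂ 2 (volume : Measure (Rn n))

variable {n : ℕ}

/-- `S` is the integral operator on `L²(ℝⁿ)` with kernel `k`: `(S f)(x) = ∫ k(x, y) f(y) dy`. -/
def IsIntegralOperator (k : 𝓢(Rn n × Rn n, ℂ)) (S : L2 n →L[ℂ] L2 n) : Prop :=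
  ∀ f : L2 n, S f =ᵐ[volume] fun x => ∫ y, k (x, y) * f y

/-- The weight `(1 + ‖x‖)^(-(n+1))`. -/
noncomputable def weight (x : Rn n) : ℝ :=
  (1 + ‖x‖) ^ (-((Module.finrank ℝ (Rn n) + 1 : ℕ) : ℝ))

lemma weight_nonneg (x : Rn n) : 0 ≤ weight x := by unfold weight; positivity

lemma weight_integrable : Integrable (weight (n := n)) volume := integrable_weight volume

lemma weight_memLp : MemLp (weight (n := n)) 2 volume := by
  rw [memLp_two_iff_integrable_sq weight_integrable.aestronglyMeasurable]
  refine weight_integrable.mono' (weight_integrable.aestronglyMeasurable.pow 2)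
    (Filter.Eventually.of_forall fun x => ?_)
  rw [norm_pow, Real.norm_of_nonneg (weight_nonneg x), pow_two]
  exact mul_le_of_le_one_left (weight_nonneg x) (weight_le_one _ x)

lemma kernel_bound (k : 𝓢(Rn n × Rn n, ℂ)) : ∃ C : ℝ, 0 ≤ C ∧ ∀ x y,
    ‖k (x, y)‖ ≤ C * weight x * weight y :=
  schwartz_prod_decay k _

lemma weight_mul_integrable (f : L2 n) : Integrable (fun y => weight y * ‖f y‖) volume :=
  weight_memLp.integrable_mul (Lp.memLp f).norm

lemma kernel_integrable (k : 𝓢(Rn n × Rn n, ℂ)) (f : L2 n) (x : Rn n) :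
    Integrable (fun y => k (x, y) * f y) volume := by
  obtain ⟨C, hC0, hC⟩ := kernel_bound k
  refine ((weight_mul_integrable f).const_mul (C * weight x)).mono'
    ((k.continuous.comp (by fun_prop)).aestronglyMeasurable.mul
      (Lp.memLp f).aestronglyMeasurable) (Filter.Eventually.of_forall fun y => ?_)
  rw [norm_mul, ← mul_assoc]
  gcongr
  exact hC x y

lemma weight_mul_integral_le (f : L2 n) :
    ∫ y, weight y * ‖f y‖ ≤ ‖weight_memLp.toLp (weight (n := n))‖ * ‖f‖ := by
  have h := real_inner_le_norm (weight_memLp.toLp (weight (n := n))) ((Lp.memLp f).norm.toLp _)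
  have h2 : ‖(Lp.memLp f).norm.toLp _‖ = ‖f‖ := by
    rw [Lp.norm_toLp, eLpNorm_norm, Lp.norm_def]
  rw [h2] at h
  refine le_trans (le_of_eq ?_) h
  rw [L2.inner_def]
  refine integral_congr_ae ?_
  filter_upwards [weight_memLp.coeFn_toLp (f := weight (n := n)),
    (Lp.memLp f).norm.coeFn_toLp] with y h1 h2
  rw [h1, h2]
  simp [mul_comm]

lemma kernel_integral_bound (k : 𝓢(Rn n × Rn n, ℂ)) {C : ℝ}
    (hC : ∀ x y, ‖k (x, y)‖ ≤ C * weight x * weight y) (f : L2 n) (x : Rn n) :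
    ‖∫ y, k (x, y) * f y‖ ≤ C * (∫ y, weight y * ‖f y‖) * weight x := by
  calc _ ≤ ∫ y, ‖k (x, y) * f y‖ := norm_integral_le_integral_norm _
    _ ≤ ∫ y, (C * weight x) * (weight y * ‖f y‖) := by
      refine integral_mono (kernel_integrable k f x).norm
        ((weight_mul_integrable f).const_mul _) fun y => ?_
      simp only [norm_mul]
      rw [← mul_assoc]
      gcongr
      exact hC x y
    _ = _ := by rw [integral_const_mul]; ring

lemma kernel_integral_memLp (k : 𝓢(Rn n × Rn n, ℂ)) (f : L2 n) :
    MemLp (fun x => ∫ y, k (x, y) * f y) 2 volume := by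
  obtain ⟨C, hC0, hC⟩ := kernel_bound k
  refine (weight_memLp.const_mul (C * ∫ y, weight y * ‖f y‖)).mono' ?_
    (Filter.Eventually.of_forall fun x => kernel_integral_bound k hC f x)
  have : AEStronglyMeasurable (fun p : Rn n × Rn n => k p * f p.2)
      ((volume : Measure (Rn n)).prod volume) :=
    k.continuous.aestronglyMeasurable.mul (Lp.memLp f).aestronglyMeasurable.comp_snd
  exact this.integral_prod_right'

/-- Every Schwartz kernel defines a bounded integral operator on `L²(ℝⁿ)`. -/
lemma exists_integralOperator (k : 𝓢(Rn n × Rn n, ℂ)) :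
    ∃ S : L2 n →L[ℂ] L2 n, IsIntegralOperator k S := by
  obtain ⟨C, hC0, hC⟩ := kernel_bound k
  let T : L2 n →ₗ[ℂ] L2 n :=
    { toFun := fun f => (kernel_integral_memLp k f).toLp _
      map_add' := fun f g => by
        rw [← MemLp.toLp_add]
        apply MemLp.toLp_congr
        refine Filter.Eventually.of_forall fun x => ?_
        simp only [Pi.add_apply]
        rw [← integral_add (kernel_integrable k f x) (kernel_integrable k g x)]
        refine integral_congr_ae ?_
        filter_upwards [Lp.coeFn_add f g] with y hy
        rw [hy, Pi.add_apply, mul_add]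
      map_smul' := fun c f => by
        rw [← MemLp.toLp_const_smul]
        apply MemLp.toLp_congr
        refine Filter.Eventually.of_forall fun x => ?_
        simp only [Pi.smul_apply, RingHom.id_apply]
        rw [← integral_smul]
        refine integral_congr_ae ?_
        filter_upwards [Lp.coeFn_smul c f] with y hy
        rw [hy, Pi.smul_apply]
        simp only [smul_eq_mul]
        ring }
  let w := weight_memLp.toLp (weight (n := n))
  refine ⟨T.mkContinuous (C * ‖w‖ * ‖w‖) fun f => ?_, fun f => ?_⟩
  · have h1 : ‖T f‖ ≤ (C * ∫ y, weight y * ‖f y‖) * ‖w‖ := by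
      apply Lp.norm_le_mul_norm_of_ae_le_mul
      filter_upwards [(kernel_integral_memLp k f).coeFn_toLp,
        weight_memLp.coeFn_toLp (f := weight (n := n))] with x h1 h2
      have h3 : (T f : Rn n → ℂ) x = ∫ y, k (x, y) * f y := h1
      rw [h3, h2, Real.norm_of_nonneg (weight_nonneg x)]
      exact kernel_integral_bound k hC f x
    calc ‖T f‖ ≤ (C * ∫ y, weight y * ‖f y‖) * ‖w‖ := h1
      _ ≤ (C * (‖w‖ * ‖f‖)) * ‖w‖ := by gcongr; exact weight_mul_integral_le f
      _ = _ := by ring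
  · exact (kernel_integral_memLp k f).coeFn_toLp

/-- The kernel `(x, y) ↦ ∫ k(x, z) l(z, y) dz` of the composition of two integral operators. -/
noncomputable def kernelComp (k l : 𝓢(Rn n × Rn n, ℂ)) : 𝓢(Rn n × Rn n, ℂ) :=
  partialIntegral volume (productMap
    (((ContinuousLinearMap.fst ℝ (Rn n) (Rn n)).comp
      (ContinuousLinearMap.fst ℝ (Rn n × Rn n) (Rn n))).prod
      (ContinuousLinearMap.snd ℝ (Rn n × Rn n) (Rn n)))
    ((ContinuousLinearMap.snd ℝ (Rn n × Rn n) (Rn n)).prod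
      ((ContinuousLinearMap.snd ℝ (Rn n) (Rn n)).comp
      (ContinuousLinearMap.fst ℝ (Rn n × Rn n) (Rn n))))
    (fun w => by
      simp only [Prod.norm_def, ContinuousLinearMap.prod_apply, ContinuousLinearMap.comp_apply,
        ContinuousLinearMap.coe_fst', ContinuousLinearMap.coe_snd']
      grind) k l)

lemma kernelComp_apply (k l : 𝓢(Rn n × Rn n, ℂ)) (x y : Rn n) :
    kernelComp k l (x, y) = ∫ z, k (x, z) * l (z, y) := rfl

lemma isIntegralOperator_mul {k l : 𝓢(Rn n × Rn n, ℂ)} {S T : L2 n →L[ℂ] L2 n}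
    (hS : IsIntegralOperator k S) (hT : IsIntegralOperator l T) :
    IsIntegralOperator (kernelComp k l) (S * T) := by
  intro f
  refine (hS (T f)).trans (Filter.Eventually.of_forall fun x => ?_)
  obtain ⟨C, hC0, hC⟩ := kernel_bound k
  obtain ⟨C', hC'0, hC'⟩ := kernel_bound l
  have hint : Integrable (Function.uncurry fun z y => k (x, z) * (l (z, y) * f y))
      ((volume : Measure (Rn n)).prod volume) := by
    refine ((weight_integrable (n := n)).mul_prod ((weight_mul_integrable f).const_mul
      (C * weight x * C'))).mono' ?_ (Filter.Eventually.of_forall fun p => ?_)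
    · exact (k.continuous.comp (by fun_prop : Continuous fun p : Rn n × Rn n =>
        (x, p.1))).aestronglyMeasurable.mul (l.continuous.aestronglyMeasurable.mul
          (Lp.memLp f).aestronglyMeasurable.comp_snd)
    · obtain ⟨z, y⟩ := p
      simp only [Function.uncurry, norm_mul]
      have h1 := hC x z
      have h2 := hC' z y
      have hz := weight_nonneg z
      have hz1 : weight z ≤ 1 := weight_le_one _ z
      have hy := weight_nonneg y
      have hx := weight_nonneg x
      calc ‖k (x, z)‖ * (‖l (z, y)‖ * ‖f y‖)
          ≤ (C * weight x * weight z) * ((C' * 1 * weight y) * ‖f y‖) := by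
            gcongr
            exact h2.trans (by gcongr)
        _ = _ := by ring
  calc ∫ z, k (x, z) * (T f) z = ∫ z, ∫ y, k (x, z) * (l (z, y) * f y) := by
        refine integral_congr_ae ?_
        filter_upwards [hT f] with z hz
        rw [hz, integral_const_mul]
    _ = ∫ y, ∫ z, k (x, z) * (l (z, y) * f y) := integral_integral_swap hint
    _ = ∫ y, kernelComp k l (x, y) * f y := by
        refine integral_congr_ae (Filter.Eventually.of_forall fun y => ?_)
        simp only [kernelComp_apply, ← mul_assoc]
        rw [integral_mul_const]

variable (n) in
/-- The algebra `K^∞` of integral operators on `L²(ℝⁿ)` with Schwartz kernels in `𝓢(ℝⁿ × ℝⁿ)`. -/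
def smoothing : NonUnitalSubalgebra ℂ (L2 n →L[ℂ] L2 n) where
  carrier := {S | ∃ k : 𝓢(Rn n × Rn n, ℂ), IsIntegralOperator k S}
  add_mem' := by
    rintro S T ⟨k, hk⟩ ⟨l, hl⟩
    refine ⟨k + l, fun f => ?_⟩
    rw [add_apply]
    filter_upwards [Lp.coeFn_add (S f) (T f), hk f, hl f] with x h1 h2 h3
    rw [h1, Pi.add_apply, h2, h3, ← integral_add (kernel_integrable k f x)
      (kernel_integrable l f x)]
    simp [add_mul]
  zero_mem' := by
    refine ⟨0, fun f => ?_⟩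
    filter_upwards [Lp.coeFn_zero ℂ 2 (volume : Measure (Rn n))] with x h1
    refine h1.trans ?_
    simp
  mul_mem' := by
    rintro S T ⟨k, hk⟩ ⟨l, hl⟩
    exact ⟨_, isIntegralOperator_mul hk hl⟩
  smul_mem' := by
    rintro c S ⟨k, hk⟩
    refine ⟨c • k, fun f => ?_⟩
    rw [smul_apply]
    filter_upwards [Lp.coeFn_smul c (S f), hk f] with x h1 h2
    rw [h1, Pi.smul_apply, h2, ← integral_smul]
    simp [mul_assoc]

/-- The partial derivative `∂/∂xⱼ` on Schwartz functions. -/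
noncomputable def partialD (j : Fin n) (f : 𝓢(Rn n, ℂ)) : 𝓢(Rn n, ℂ) :=
  ∂_{EuclideanSpace.single j (1 : ℝ)} f

lemma coord_hasTemperateGrowth (j : Fin n) :
    (fun x : Rn n => ((x j : ℝ) : ℂ)).HasTemperateGrowth :=
  (Complex.ofRealCLM.comp (EuclideanSpace.proj (𝕜 := ℝ) j)).hasTemperateGrowth

/-- Multiplication by the `j`-th coordinate function on Schwartz functions. -/
noncomputable def coordMul (j : Fin n) (f : 𝓢(Rn n, ℂ)) : 𝓢(Rn n, ℂ) :=
  SchwartzMap.smulLeftCLM ℂ (fun x : Rn n => ((x j : ℝ) : ℂ)) f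

lemma coordMul_apply (j : Fin n) (f : 𝓢(Rn n, ℂ)) (x : Rn n) :
    coordMul j f x = (x j : ℂ) * f x :=
  SchwartzMap.smulLeftCLM_apply_apply (coord_hasTemperateGrowth j) f x

/-- The class in `L²(ℝⁿ)` of a Schwartz function. -/
noncomputable def toL2 (f : 𝓢(Rn n, ℂ)) : L2 n := f.toLp 2 volume

/-- `D` is the bounded extension to `L²(ℝⁿ)` of the commutator `[A, S] = A S - S A`, where `A` is an
operator defined on the Schwartz space, which `S` has to preserve. -/
def IsCommutator (A : 𝓢(Rn n, ℂ) → 𝓢(Rn n, ℂ)) (S D : L2 n →L[ℂ] L2 n) : Prop :=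
  ∀ f : 𝓢(Rn n, ℂ), ∃ g : 𝓢(Rn n, ℂ), S (toL2 f) = toL2 g ∧
    D (toL2 f) = toL2 (A g) - S (toL2 (A f))

/-- The action of a Schwartz kernel on Schwartz functions. -/
noncomputable def kernelAct (k : 𝓢(Rn n × Rn n, ℂ)) (f : 𝓢(Rn n, ℂ)) : 𝓢(Rn n, ℂ) :=
  partialIntegral volume (productMap (ContinuousLinearMap.id ℝ (Rn n × Rn n))
    (ContinuousLinearMap.snd ℝ (Rn n) (Rn n)) (fun _ => le_max_left _ _) k f)

lemma kernelAct_apply (k : 𝓢(Rn n × Rn n, ℂ)) (f : 𝓢(Rn n, ℂ)) (x : Rn n) :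
    kernelAct k f x = ∫ y, k (x, y) * f y := rfl

lemma coeFn_toL2 (f : 𝓢(Rn n, ℂ)) : toL2 f =ᵐ[volume] f := f.coeFn_toLp 2 volume

lemma kernelAct_integrable (k : 𝓢(Rn n × Rn n, ℂ)) (f : 𝓢(Rn n, ℂ)) (x : Rn n) :
    Integrable (fun y => k (x, y) * f y) volume := by
  refine (kernel_integrable k (toL2 f) x).congr ?_
  filter_upwards [coeFn_toL2 f] with y hy
  rw [hy]

lemma IsIntegralOperator.apply_toLp {k : 𝓢(Rn n × Rn n, ℂ)} {S : L2 n →L[ℂ] L2 n}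
    (hS : IsIntegralOperator k S) (f : 𝓢(Rn n, ℂ)) :
    S (toL2 f) = toL2 (kernelAct k f) := by
  refine Lp.ext ?_
  filter_upwards [hS (toL2 f), coeFn_toL2 (kernelAct k f)]
    with x h1 h2
  rw [h1, h2, kernelAct_apply]
  refine integral_congr_ae ?_
  filter_upwards [coeFn_toL2 f] with y hy
  rw [hy]

/-- A kernel identity on Schwartz functions gives a commutator identity. -/
lemma isCommutator_of_kernel {A : 𝓢(Rn n, ℂ) → 𝓢(Rn n, ℂ)} {k k' : 𝓢(Rn n × Rn n, ℂ)}
    {S D : L2 n →L[ℂ] L2 n} (hS : IsIntegralOperator k S) (hD : IsIntegralOperator k' D)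
    (h : ∀ f, kernelAct k' f = A (kernelAct k f) - kernelAct k (A f)) : IsCommutator A S D := by
  intro f
  refine ⟨kernelAct k f, hS.apply_toLp f, ?_⟩
  rw [hD.apply_toLp, hS.apply_toLp, h f]
  exact map_sub (SchwartzMap.toLpCLM ℂ ℂ 2 (volume : Measure (Rn n))) _ _

/-- The commutator of `xⱼ` with an element of `K^∞` is an element of `K^∞`. -/
lemma exists_commutator_coordMul (j : Fin n) (S : smoothing n) :
    ∃ D : smoothing n, IsCommutator (coordMul j) S D := by
  obtain ⟨S, k, hk⟩ := S
  have hg : (fun p : Rn n × Rn n => ((p.1 j - p.2 j : ℝ) : ℂ)).HasTemperateGrowth :=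
    (Complex.ofRealCLM.comp (((EuclideanSpace.proj (𝕜 := ℝ) j).comp
      (ContinuousLinearMap.fst ℝ (Rn n) (Rn n))) - ((EuclideanSpace.proj (𝕜 := ℝ) j).comp
      (ContinuousLinearMap.snd ℝ (Rn n) (Rn n))))).hasTemperateGrowth
  obtain ⟨D, hD⟩ := exists_integralOperator
    (SchwartzMap.smulLeftCLM ℂ (fun p : Rn n × Rn n => ((p.1 j - p.2 j : ℝ) : ℂ)) k)
  refine ⟨⟨D, _, hD⟩, isCommutator_of_kernel hk hD fun f => ?_⟩
  ext x
  rw [sub_apply, coordMul_apply, kernelAct_apply, kernelAct_apply, kernelAct_apply,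
    ← integral_const_mul, ← integral_sub ((kernelAct_integrable k f x).const_mul _)
      (kernelAct_integrable k _ x)]
  refine integral_congr_ae (Filter.Eventually.of_forall fun y => ?_)
  simp only [SchwartzMap.smulLeftCLM_apply_apply hg, coordMul_apply, smul_eq_mul]
  push_cast
  ring

/-- The commutator of `∂/∂xⱼ` with an element of `K^∞` is an element of `K^∞`. -/
lemma exists_commutator_partialD (j : Fin n) (S : smoothing n) :
    ∃ D : smoothing n, IsCommutator (partialD j) S D := by
  obtain ⟨S, k, hk⟩ := S
  set e : Rn n := EuclideanSpace.single j (1 : ℝ) with he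
  obtain ⟨D, hD⟩ := exists_integralOperator (∂_{((e, 0) : Rn n × Rn n)} k +
    ∂_{((0, e) : Rn n × Rn n)} k)
  refine ⟨⟨D, _, hD⟩, isCommutator_of_kernel hk hD fun f => ?_⟩
  ext x
  have h1 : partialD j (kernelAct k f) x = ∫ y, ∂_{((e, 0) : Rn n × Rn n)} k (x, y) * f y := by
    rw [partialD, SchwartzMap.lineDerivOp_apply_eq_fderiv, ← he]
    let F := productMap (ContinuousLinearMap.id ℝ (Rn n × Rn n))
      (ContinuousLinearMap.snd ℝ (Rn n) (Rn n)) (fun _ => le_max_left _ _) k f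
    have hd : fderiv ℝ (kernelAct k f) x = ∫ y, partialFDeriv F (x, y) :=
      (hasFDerivAt_partialIntegral volume F x).fderiv
    rw [hd, ContinuousLinearMap.integral_apply (integrable_schwartz_slice volume _ x)]
    refine integral_congr_ae (Filter.Eventually.of_forall fun y => ?_)
    have ha : HasFDerivAt (fun x => k (x, y) * f y) _ x :=
      (hasFDerivAt_partial k x y).mul_const (f y)
    have hb : HasFDerivAt (fun x => k (x, y) * f y) (partialFDeriv F (x, y)) x :=
      hasFDerivAt_partial F x y
    simp only []
    rw [hb.unique ha, SchwartzMap.lineDerivOp_apply_eq_fderiv]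
    simp [partialFDeriv_apply, mul_comm]
  have hd2 : ∀ y, HasFDerivAt (fun y => k (x, y))
      ((fderiv ℝ k (x, y)).comp (ContinuousLinearMap.inr ℝ (Rn n) (Rn n))) y := fun y =>
    HasFDerivAt.comp (f := fun e => (x, e)) y (k.hasFDerivAt (x, y)) (hasFDerivAt_prodMk_right x y)
  have h2 : ∫ y, k (x, y) * partialD j f y =
      - ∫ y, ∂_{((0, e) : Rn n × Rn n)} k (x, y) * f y := by
    have hk2 : ∀ y, ∂_{((0, e) : Rn n × Rn n)} k (x, y) = fderiv ℝ (fun y => k (x, y)) y e := by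
      intro y
      rw [(hd2 y).fderiv, SchwartzMap.lineDerivOp_apply_eq_fderiv]
      simp
    have hf2 : ∀ y, partialD j f y = fderiv ℝ f y e := fun y => by
      rw [partialD, SchwartzMap.lineDerivOp_apply_eq_fderiv]
    have i1 := kernelAct_integrable (∂_{((0, e) : Rn n × Rn n)} k) f x
    have i2 := kernelAct_integrable k (partialD j f) x
    simp only [hk2] at i1 ⊢
    simp only [hf2] at i2 ⊢
    exact integral_mul_fderiv_eq_neg_fderiv_mul_of_integrable i1 i2 (kernelAct_integrable k f x)
      (fun y _ => (hd2 y).differentiableAt) (fun y _ => f.differentiableAt)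
  rw [sub_apply, h1, kernelAct_apply, kernelAct_apply, h2, sub_neg_eq_add,
    ← integral_add (kernelAct_integrable _ f x) (kernelAct_integrable _ f x)]
  refine integral_congr_ae (Filter.Eventually.of_forall fun y => ?_)
  simp [add_mul]

/-- The derivations of `K^∞`, indexed from `0` to `2n - 1`: the one with index `2j` is
`S ↦ [∂/∂xⱼ, S]` and the one with index `2j + 1` is `S ↦ [xⱼ, S]` (coordinates `x₀, …, x_{n-1}`). -/
noncomputable def delta (i : Fin (2 * n)) (S : smoothing n) : smoothing n :=
  if (i : ℕ) % 2 = 0 then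
    (exists_commutator_partialD ⟨(i : ℕ) / 2, by omega⟩ S).choose
  else
    (exists_commutator_coordMul ⟨(i : ℕ) / 2, by omega⟩ S).choose

/-- `S` is of trace class with trace `z`: for every orthonormal basis `(bᵢ)`, the diagonal series
`∑ᵢ ⟨bᵢ, S bᵢ⟩` converges unconditionally to `z`. -/
def HasTrace (S : L2 n →L[ℂ] L2 n) (z : ℂ) : Prop :=
  ∀ (ι : Type) (b : HilbertBasis ι ℂ (L2 n)), HasSum (fun i => ⟪b i, S (b i)⟫_ℂ) z

open Classical in
/-- The canonical trace `Tr` (with value `0` outside the trace class). -/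
noncomputable def opTrace (S : L2 n →L[ℂ] L2 n) : ℂ :=
  if h : ∃ z, HasTrace S z then h.choose else 0

/-- The operator `T₀ δ_{σ(1)}(T₁) ⋯ δ_{σ(2n)}(T_{2n})`. -/
noncomputable def omegaProduct (σ : Equiv.Perm (Fin (2 * n)))
    (T : Fin (2 * n + 1) → smoothing n) : L2 n →L[ℂ] L2 n :=
  T 0 * (List.ofFn fun i : Fin (2 * n) => (delta (σ i) (T i.succ) : L2 n →L[ℂ] L2 n)).prod

/-- `ω(T₀, …, T_{2n}) = (-1)ⁿ / n! ∑_σ sgn(σ) Tr(T₀ δ_{σ(1)}(T₁) ⋯ δ_{σ(2n)}(T_{2n}))`. -/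
noncomputable def omega (T : Fin (2 * n + 1) → smoothing n) : ℂ :=
  (-1) ^ n / (n.factorial : ℂ) * ∑ σ : Equiv.Perm (Fin (2 * n)),
    ((Equiv.Perm.sign σ : ℤ) : ℂ) * opTrace (omegaProduct σ T)

end Operators

end SmoothingOps

namespace CyclicCohomology

section

variable (A : Type) [NonUnitalRing A] [Module ℂ A]

/-- Hochschild `m`-cochains: `(m+1)`-linear functionals on `A`. -/
abbrev Cochain (m : ℕ) : Type := MultilinearMap ℂ (fun _ : Fin (m + 1) => A) ℂ

variable {A}

/-- `φ(a₀, …, aₘ) = (-1)ᵐ φ(aₘ, a₀, …, a_{m-1})`. -/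
def IsCyclic {m : ℕ} (φ : Cochain A m) : Prop :=
  ∀ a : Fin (m + 1) → A, φ a = (-1) ^ m * φ (fun j => a (j - 1))

/-- The Hochschild coboundary
`(bφ)(a₀, …, a_{m+1}) = ∑_{i ≤ m} (-1)ⁱ φ(a₀, …, aᵢ aᵢ₊₁, …, a_{m+1})`
`+ (-1)^{m+1} φ(a_{m+1} a₀, a₁, …, aₘ)`. -/
def hochschildB {m : ℕ} (φ : Cochain A m) (a : Fin (m + 2) → A) : ℂ :=
  ∑ i : Fin (m + 1), (-1) ^ (i : ℕ) * φ (Fin.contractNth i.castSucc (· * ·) a) +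
    (-1) ^ (m + 1) *
      φ (fun j => if j = 0 then a (Fin.last (m + 1)) * a 0 else a j.castSucc)

lemma hochschildB_add {m : ℕ} (φ ψ : Cochain A m) (a : Fin (m + 2) → A) :
    hochschildB (φ + ψ) a = hochschildB φ a + hochschildB ψ a := by
  simp only [hochschildB, add_apply, mul_add, Finset.sum_add_distrib]
  ring

lemma hochschildB_smul {m : ℕ} (c : ℂ) (φ : Cochain A m) (a : Fin (m + 2) → A) :
    hochschildB (c • φ) a = c * hochschildB φ a := by
  simp only [hochschildB, smul_apply, smul_eq_mul, mul_add, Finset.mul_sum]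
  congr 1
  · exact Finset.sum_congr rfl fun i _ => by ring
  · ring

lemma IsCyclic.add {m : ℕ} {φ ψ : Cochain A m} (hφ : IsCyclic φ) (hψ : IsCyclic ψ) :
    IsCyclic (φ + ψ) := fun a => by
  rw [add_apply, add_apply, hφ a, hψ a, mul_add]

lemma IsCyclic.smul {m : ℕ} {φ : Cochain A m} (c : ℂ) (hφ : IsCyclic φ) :
    IsCyclic (c • φ) := fun a => by
  rw [smul_apply, smul_apply, hφ a, smul_eq_mul, smul_eq_mul]
  ring

lemma isCyclic_zero {m : ℕ} : IsCyclic (0 : Cochain A m) := fun a => by simp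

variable (A)

/-- Cyclic `m`-cocycles on `A`. -/
def cocycles (m : ℕ) : Submodule ℂ (Cochain A m) where
  carrier := {φ | IsCyclic φ ∧ ∀ a, hochschildB φ a = 0}
  add_mem' := fun h h' => ⟨h.1.add h'.1, fun a => by rw [hochschildB_add, h.2, h'.2, add_zero]⟩
  zero_mem' := ⟨isCyclic_zero, fun a => by simp [hochschildB]⟩
  smul_mem' := fun c _ h => ⟨h.1.smul c, fun a => by rw [hochschildB_smul, h.2, mul_zero]⟩

/-- Cyclic coboundaries in degree `m`: the Hochschild coboundaries of cyclic `(m-1)`-cochains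
(only `0` in degree `0`). -/
def coboundaries : (m : ℕ) → Submodule ℂ (cocycles A m)
  | 0 => ⊥
  | m + 1 =>
    { carrier := {φ | ∃ ψ : Cochain A m, IsCyclic ψ ∧ ∀ a, φ.1 a = hochschildB ψ a}
      add_mem' := by
        rintro φ φ' ⟨ψ, h, e⟩ ⟨ψ', h', e'⟩
        refine ⟨ψ + ψ', h.add h', fun a => ?_⟩
        rw [hochschildB_add, ← e, ← e']
        rfl
      zero_mem' := ⟨0, isCyclic_zero, fun a => by simp [hochschildB]⟩
      smul_mem' := by
        rintro c φ ⟨ψ, h, e⟩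
        refine ⟨c • ψ, h.smul c, fun a => ?_⟩
        rw [hochschildB_smul, ← e]
        rfl }

/-- The cyclic cohomology `HCᵐ(A)`, computed by the complex of cyclic cochains. -/
abbrev HC (m : ℕ) : Type := cocycles A m ⧸ coboundaries A m

variable {A}

/-- The class in `HCᵐ(A)` of a cyclic cocycle. -/
def HC.mk {m : ℕ} (φ : cocycles A m) : HC A m := Submodule.Quotient.mk φ

/-- `(φ # tr)(M₀, …, Mₘ) = ∑ φ((M₀)_{i₀ i₁}, (M₁)_{i₁ i₂}, …, (Mₘ)_{iₘ i₀})`, the extension of `φ`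
to matrices over `A`. -/
def cupTr {m k : ℕ} (φ : Cochain A m) (M : Fin (m + 1) → Matrix (Fin k) (Fin k) A) : ℂ :=
  ∑ i : Fin (m + 1) → Fin k, φ (fun j => M j (i j) (i (j + 1)))

/-- Connes' pairing of an idempotent matrix `e` over `A` with a cyclic `2l`-cocycle `φ`:
`(2πi)⁻ˡ (l!)⁻¹ (φ # tr)(e, …, e)`. -/
noncomputable def pairing {l k : ℕ} (e : Matrix (Fin k) (Fin k) A) (φ : cocycles A (2 * l)) : ℂ :=
  ((2 * Real.pi * Complex.I) ^ l)⁻¹ * ((l.factorial : ℂ))⁻¹ * cupTr φ.1 (fun _ => e)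

/-- Two idempotent matrices `e`, `f` over the (non-unital) algebra `A` define the same class in
`K₀(A)`: after adding the same identity matrix, they become equivalent (of the form `uv` and `vu`)
over the unitization of `A`. -/
def SameK0Class [IsScalarTower ℂ A A] [SMulCommClass ℂ A A] {k l : ℕ}
    (e : Matrix (Fin k) (Fin k) A) (f : Matrix (Fin l) (Fin l) A) : Prop :=
  ∃ (r : ℕ) (u : Matrix (Fin k ⊕ Fin r) (Fin l ⊕ Fin r) (Unitization ℂ A))
    (v : Matrix (Fin l ⊕ Fin r) (Fin k ⊕ Fin r) (Unitization ℂ A)),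
    u * v = Matrix.fromBlocks (e.map Unitization.inr) 0 0 1 ∧
    v * u = Matrix.fromBlocks (f.map Unitization.inr) 0 0 1

end

end CyclicCohomology

open SmoothingOps CyclicCohomology

/-! The operators `X_a` (the `∂/∂xⱼ` and `xⱼ`) act on Schwartz functions with scalar commutators.
Tensoring with the Grassmann algebra on generators `θ_a` gives an odd Dirac element `D = ∑ θ_a ⊗
X_a`, and `D² = Ω ⊗ 1` with `Ω = ∑ θ_{2j} θ_{2j+1}`. Hence `D²` commutes with `K^∞`, and `da = [D,
a]`, whose components are the derivations `δ`, behaves like a differential. Berezin integral tensor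
trace is a closed graded trace, so Connes' argument makes `T(a₀ da₁ ⋯ da_{2n})` a cyclic cocycle.
The Berezin integral extracts the top coefficient and antisymmetrizes, so this character times
`(-1)ⁿ / n!` is `ω` (`omegaCocycle_apply`).

For an idempotent `e` put `B = eDe`. Then `e (de)² = B² - D² e`. Since `B` is an odd form with
coefficients in `K^∞`, the supertrace of `B` times an odd element commuting with it vanishes, and
every `B²` can be discarded. What remains is `(-1)ⁿ T((D²)ⁿ e)`, which is `(-1)ⁿ (∫ Ωⁿ) Tr(e)` with
Berezin integral `∫ Ωⁿ = n!`. So `ω(e, …, e) = Tr(e)` by pure algebra, and the same computation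
applies to matrices (`DiracCycle.character_idempotent`, `berezin_symplectic_pow`,
`cupTr_omegaCocycle`).

Changing the representative of the class costs nothing: the coboundary of a cyclic cochain of odd
degree vanishes on idempotents (`cupTr_eq_of_HC_eq`), and a trace does not distinguish `uv` from
`vu` (`trace_eq_of_sameK0Class`).

The analytic input is that a Schwartz kernel gives a trace class operator with trace `∫ k(x, x) dx`.
Fourier inversion writes the operator as an absolutely convergent superposition of rank one
operators (`hasTrace_of_isIntegralOperator`). The trace property is then Fubini, and invariance
under `∂/∂xⱼ` is integration by parts on the diagonal. -/

namespace CyclicCohomology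

/-- A non-unital algebra `A` of even elements in a superalgebra `Q` (with grading involution `α`),
together with an odd element `D` whose square commutes with `A` and a supertrace `T`, defined on
an ideal-like subspace `N`, that vanishes on supercommutators with `D`. -/
structure DiracCycle (A Q : Type) [NonUnitalRing A] [Module ℂ A] [Ring Q] [Algebra ℂ Q] where
  ι : A →ₙₐ[ℂ] Q
  α : Q →ₐ[ℂ] Q
  D : Q
  T : Q →ₗ[ℂ] ℂ
  N : Submodule ℂ Q
  α_ι : ∀ a, α (ι a) = ι a
  α_D : α D = -D
  sq_comm : ∀ a, D * D * ι a = ι a * (D * D)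
  mul_mem : ∀ {x y}, x ∈ N → y ∈ N → x * y ∈ N
  ι_mem : ∀ a, ι a ∈ N
  d_mem : ∀ a, D * ι a - ι a * D ∈ N
  trace_even : ∀ a, ∀ y ∈ N, T (ι a * y) = T (y * ι a)
  trace_d : ∀ a, ∀ y ∈ N, T ((D * ι a - ι a * D) * y) = T (α y * (D * ι a - ι a * D))
  closed : ∀ y ∈ N, T (D * y) = T (α y * D)

/-! ### Characters of Dirac cycles: cocycle property, cyclicity, values on idempotents. -/

namespace DiracCycle

variable {A Q : Type} [NonUnitalRing A] [Module ℂ A] [Ring Q] [Algebra ℂ Q] (C : DiracCycle A Q)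

/-- The differential `a ↦ [D, a]` on `A`. -/
def d : A →ₗ[ℂ] Q := (LinearMap.mulLeft ℂ C.D - LinearMap.mulRight ℂ C.D) ∘ₗ (C.ι : A →ₗ[ℂ] Q)

lemma d_apply (a : A) : C.d a = C.D * C.ι a - C.ι a * C.D := rfl

lemma d_mul (a b : A) : C.d (a * b) = C.d a * C.ι b + C.ι a * C.d b := by
  simp only [d_apply, map_mul]; noncomm_ring

lemma α_d (a : A) : C.α (C.d a) = -C.d a := by
  simp only [d_apply, map_sub, map_mul, C.α_ι, C.α_D]; noncomm_ring

/-- The graded commutator of `D` with `da` is `[D², a] = 0`; this is the substitute for `d² = 0`. -/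
lemma D_mul_d (a : A) : C.D * C.d a = -(C.d a * C.D) := by
  have h := C.sq_comm a
  simp only [d_apply, mul_sub, sub_mul, ← mul_assoc] at h ⊢
  rw [h]; abel

/-- The product `da₀ ⋯ da_{m-1}`. -/
def forms {m : ℕ} (a : Fin m → A) : Q := (List.ofFn fun i => C.d (a i)).prod

/-- The noncommutative form `a₀ da₁ ⋯ daₘ`. -/
def form {m : ℕ} (a : Fin (m + 1) → A) : Q := C.ι (a 0) * C.forms fun i => a i.succ

lemma forms_succ_last {m : ℕ} (a : Fin (m + 1) → A) :
    C.forms a = C.forms (fun i => a i.castSucc) * C.d (a (Fin.last m)) := by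
  simp only [forms]
  rw [List.ofFn_succ', List.concat_eq_append, List.prod_append, List.prod_singleton]

lemma forms_succ {m : ℕ} (a : Fin (m + 1) → A) :
    C.forms a = C.d (a 0) * C.forms (fun i => a i.succ) := by
  simp only [forms]
  rw [List.ofFn_succ, List.prod_cons]

lemma form_succ_last {m : ℕ} (a : Fin (m + 2) → A) :
    C.form a = C.form (fun i => a i.castSucc) * C.d (a (Fin.last (m + 1))) := by
  rw [form, forms_succ_last, ← mul_assoc]; rfl

lemma form_mem {m : ℕ} (a : Fin (m + 1) → A) : C.form a ∈ C.N := by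
  induction m with
  | zero => simpa [form, forms] using C.ι_mem _
  | succ m ih => rw [form_succ_last]; exact C.mul_mem (ih _) (C.d_mem _)

lemma α_forms {m : ℕ} (a : Fin m → A) : C.α (C.forms a) = (-1) ^ m * C.forms a := by
  induction m with
  | zero => simp [forms]
  | succ m ih => rw [forms_succ_last, map_mul, ih, α_d, pow_succ]; noncomm_ring

lemma α_form {m : ℕ} (a : Fin (m + 1) → A) : C.α (C.form a) = (-1) ^ m * C.form a := by
  rw [form, map_mul, C.α_ι, α_forms]
  rcases neg_one_pow_eq_or Q m with h | h <;> simp [h]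

lemma D_mul_forms {m : ℕ} (a : Fin m → A) : C.D * C.forms a = (-1) ^ m * (C.forms a * C.D) := by
  induction m with
  | zero => simp [forms]
  | succ m ih =>
    rw [forms_succ_last, ← mul_assoc, ih, mul_assoc, mul_assoc, D_mul_d, pow_succ]
    noncomm_ring

/-- The character of the cycle, as a multilinear functional. -/
noncomputable def character (m : ℕ) : Cochain A m :=
  C.T.compMultilinearMap
    ((MultilinearMap.mkPiAlgebraFin ℂ (m + 1) Q).compLinearMap
      (Fin.cons (C.ι : A →ₗ[ℂ] Q) fun _ => C.d))

lemma character_apply {m : ℕ} (a : Fin (m + 1) → A) : C.character m a = C.T (C.form a) := by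
  simp [character, form, forms, List.ofFn_succ]

/-- The Leibniz rule makes the alternating sum telescope: each `d(aᵢ aᵢ₊₁)` splits into two terms
that cancel against those of its neighbours. Only the term with the last argument undifferentiated,
on the far right, survives. -/
lemma sum_form_contractNth {m : ℕ} (a : Fin (m + 2) → A) :
    ∑ i : Fin (m + 1), (-1 : Q) ^ (i : ℕ) * C.form (Fin.contractNth i.castSucc (· * ·) a) =
      (-1) ^ m * (C.form (fun i => a i.castSucc) * C.ι (a (Fin.last (m + 1)))) := by
  induction m with
  | zero => simp [form, forms, Fin.contractNth]
  | succ m ih =>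
    rw [Fin.sum_univ_castSucc]
    have h1 : ∀ i : Fin (m + 1),
        C.form (Fin.contractNth i.castSucc.castSucc (· * ·) a) =
          C.form (Fin.contractNth i.castSucc (· * ·) fun i => a i.castSucc) *
            C.d (a (Fin.last (m + 2))) := by
      intro i
      rw [form_succ_last]
      congr 2
      rw [Fin.contractNth_apply_of_gt]
      · rfl
      · simpa using Nat.lt_succ_iff.1 i.2
    have h2 : C.form (Fin.contractNth (Fin.last (m + 1)).castSucc (· * ·) a) =
        C.form (fun i => a i.castSucc.castSucc) *
          C.d (a (Fin.last (m + 1)).castSucc * a (Fin.last (m + 2))) := by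
      rw [form_succ_last]
      congr 2
      · funext i
        rw [Fin.contractNth_apply_of_lt _ _ _ _ (by simpa using Nat.lt_succ_iff.1 i.2)]
      · rw [Fin.contractNth_apply_of_eq _ _ _ _ (by simp)]
        rfl
    simp only [h1, h2, Fin.val_castSucc, ← mul_assoc, ← Finset.sum_mul]
    rw [ih, d_mul, form_succ_last, Fin.val_last, pow_succ]
    noncomm_ring

/-- The telescoped sum leaves `(-1)ᵐ T(y a_{m+1})`, which cancels the cyclic term `(-1)^{m+1}
T(a_{m+1} y)` because even elements can be rotated under `T`. -/
lemma hochschildB_character {m : ℕ} (a : Fin (m + 2) → A) : hochschildB (C.character m) a = 0 := by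
  have key : ∀ (k : ℕ) (x : Q), (-1 : ℂ) ^ k * C.T x = C.T ((-1) ^ k * x) := by
    intro k x
    rcases Nat.even_or_odd k with h | h <;> simp [h.neg_one_pow]
  have h3 : C.form (fun j => if j = 0 then a (Fin.last (m + 1)) * a 0 else a j.castSucc) =
      C.ι (a (Fin.last (m + 1))) * C.form (fun i => a i.castSucc) := by
    simp [form, mul_assoc]
  simp only [hochschildB, character_apply, key]
  rw [← map_sum, sum_form_contractNth, h3, ← key, ← key, C.trace_even _ _ (C.form_mem _), pow_succ]
  ring

/-- With `z` the last argument and `y` the form in the others, closedness of `T` applied to `z y`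
gives `T(dz y) + T(z dy) = 0`. Here `z dy` is the rotated form, and `T(dz y) = -T(y dz)` since `y`
is odd. -/
lemma isCyclic_character {m : ℕ} (hm : Even m) : IsCyclic (C.character m) := by
  intro a
  rw [hm.neg_one_pow, one_mul]
  obtain - | m := m
  · congr 1
    funext i
    exact congrArg a (Fin.ext (by omega))
  have hm' : (-1 : Q) ^ m = -1 := Odd.neg_one_pow (by grind)
  rw [character_apply, character_apply, form_succ_last]
  set y := C.form fun i => a i.castSucc with hy
  set w := C.forms fun i : Fin m => a i.succ.castSucc with hw
  have hyw : y = C.ι (a 0) * w := rfl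
  set z := a (Fin.last (m + 1))
  have h1 := C.trace_d z y (C.form_mem _)
  have h2 := C.closed _ (C.mul_mem (C.ι_mem z) (C.form_mem fun i => a i.castSucc))
  have h3 : C.form (fun j => a (j - 1)) = C.ι z * (C.d (a 0) * w) := by
    rw [form, forms_succ]
    have e0 : (0 : Fin (m + 2)) - 1 = Fin.last (m + 1) := by
      rw [sub_eq_iff_eq_add, Fin.last_add_one]
    have e1 : ∀ i : Fin (m + 1), i.succ - 1 = i.castSucc := fun i => by
      rw [sub_eq_iff_eq_add, Fin.coeSucc_eq_succ]
    simp only [e0, e1]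
    rfl
  have h4 := C.D_mul_forms fun i : Fin m => a i.succ.castSucc
  rw [hm', ← hw] at h4
  rw [← hy, map_mul C.α, C.α_ι, C.α_form, hm', ← hy] at h2
  rw [C.α_form, hm', ← hy, ← C.d_apply] at h1
  -- Moving `D` to the right past `z`, `a₀` and the odd number of one-forms in `w`; the last term is
  -- exactly the right-hand side of closedness.
  have h5 : C.D * (C.ι z * y) = C.d z * y + C.ι z * (C.d (a 0) * w) +
      C.ι z * (-1 * y) * C.D := by
    have : C.D * (C.ι z * y) = C.d z * y + C.ι z * (C.d (a 0) * w) +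
      C.ι z * C.ι (a 0) * (C.D * w) := by
      rw [hyw, C.d_apply, C.d_apply]; noncomm_ring
    rw [this, h4, hyw]; noncomm_ring
  rw [h5, map_add, map_add] at h2
  rw [h3]
  simp only [neg_mul, one_mul, map_neg] at h1
  linear_combination h1 - h2

/-- The character of a cycle, as a cyclic cocycle. -/
noncomputable def cocycle (m : ℕ) (hm : Even m) : cocycles A m :=
  ⟨C.character m, C.isCyclic_character hm, C.hochschildB_character⟩

/-- Because `e` commutes with `(de)²`, the power reduces to the corner identity `e (de)² = (eDe)² -
D² e`: the curvature of the compressed operator minus the compressed curvature. -/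
lemma ι_mul_d_pow {e : A} (he : e * e = e) (n : ℕ) : C.ι e * C.d e ^ (2 * n) =
    C.ι e * ((C.ι e * C.D * C.ι e) * (C.ι e * C.D * C.ι e) - C.D * C.D * C.ι e) ^ n := by
  set E := C.ι e with hE
  set B := E * C.D * E with hB
  have hEE : E * E = E := by rw [hE, ← map_mul, he]
  have hEE' : ∀ x, E * (E * x) = E * x := fun x => by rw [← mul_assoc, hEE]
  have hDE : ∀ x, C.D * (C.D * (E * x)) = E * (C.D * (C.D * x)) := fun x => by
    have := congrArg (· * x) (C.sq_comm e)
    simpa only [mul_assoc] using this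
  have hDE' : C.D * (C.D * E) = E * (C.D * C.D) := by simpa [mul_assoc] using C.sq_comm e
  have h1 : E * C.d e ^ 2 = B * B - C.D * C.D * E := by
    rw [pow_two, d_apply, ← hE, hB]
    simp only [mul_sub, sub_mul, mul_assoc, hEE', hDE']
    abel
  have h2 : C.d e ^ 2 * E = E * C.d e ^ 2 := by
    rw [h1, pow_two, d_apply, ← hE, hB]
    simp only [mul_sub, sub_mul, mul_assoc, hEE, hEE', hDE']
    abel
  induction n with
  | zero => simp
  | succ n ih =>
    rw [pow_succ (_ - _), ← mul_assoc, ← ih, ← h1, mul_add, mul_one, pow_add]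
    have h3 : Commute (C.d e ^ (2 * n)) E := by
      rw [pow_mul]; exact (show Commute (C.d e ^ 2) E from h2).pow_left n
    rw [mul_assoc E, ← mul_assoc (C.d e ^ (2 * n)) E, h3.eq, mul_assoc, hEE']

/-- With `B = eDe`, `W = D² e` and `Z = B² - W`, all three commute. The contribution of `B²` in one
factor `Z` has zero supertrace, so each `Z` may be replaced by `-W`. The free exponent `k` absorbs
the factors already replaced. -/
lemma trace_corner_pow {e : A} (he : e * e = e) (hB : C.ι e * C.D * C.ι e ∈ C.N)
    (hBtr : ∀ y ∈ C.N, C.T (C.ι e * C.D * C.ι e * y) = C.T (C.α y * (C.ι e * C.D * C.ι e)))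
    (hW : ∀ y ∈ C.N, C.D * C.D * y ∈ C.N) (j : ℕ) : ∀ k : ℕ,
    C.T (C.ι e * (((C.ι e * C.D * C.ι e) * (C.ι e * C.D * C.ι e) - C.D * C.D * C.ι e) ^ j *
      (C.D * C.D * C.ι e) ^ k)) = (-1) ^ j * C.T (C.ι e * (C.D * C.D * C.ι e) ^ (j + k)) := by
  set E := C.ι e with hE
  set B := E * C.D * E with hB'
  set W := C.D * C.D * E with hW'
  have hEE : E * E = E := by rw [hE, ← map_mul, he]
  have hEE' : ∀ x, E * (E * x) = E * x := fun x => by rw [← mul_assoc, hEE]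
  have hDE : ∀ x, C.D * (C.D * (E * x)) = E * (C.D * (C.D * x)) := fun x => by
    have := congrArg (· * x) (C.sq_comm e)
    simpa only [mul_assoc] using this
  have hDE' : C.D * (C.D * E) = E * (C.D * C.D) := by simpa [mul_assoc] using C.sq_comm e
  have hBW : Commute B W := by
    rw [Commute, SemiconjBy, hB', hW']
    simp only [mul_assoc, hEE', hDE, hDE']
  have hEB : Commute E B := by
    rw [Commute, SemiconjBy, hB']
    simp only [mul_assoc, hEE, hEE']
  have hEB' : E * B = B := by rw [hB', ← mul_assoc, ← mul_assoc, hEE]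
  have hWmem : W ∈ C.N := hW _ (C.ι_mem e)
  have hpow : ∀ {x y : Q}, x ∈ C.N → y ∈ C.N → ∀ k : ℕ, x * y ^ k ∈ C.N := by
    intro x y hx hy k
    induction k with
    | zero => simpa
    | succ k ih => rw [pow_succ, ← mul_assoc]; exact C.mul_mem ih hy
  have hαB : C.α B = -B := by
    rw [hB', hE]; simp [C.α_ι, C.α_D]
  have hαW : C.α W = W := by
    rw [hW', hE]; simp [C.α_ι, C.α_D]
  have hZ : B * B - W ∈ C.N := C.N.sub_mem (C.mul_mem hB hB) hWmem
  induction j with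
  | zero => intro k; simp
  | succ j ih =>
    intro k
    set Z := B * B - W with hZ'
    have hBZ : Commute B Z := ((Commute.refl B).mul_right (Commute.refl B)).sub_right hBW
    have hZW : Commute Z W := (hBW.mul_left hBW).sub_left (Commute.refl W)
    have hy : B * Z ^ j * W ^ k ∈ C.N := hpow (hpow hB hZ j) hWmem k
    have h1 := hBtr _ hy
    have hαy : C.α (B * Z ^ j * W ^ k) = -(B * Z ^ j * W ^ k) := by
      simp [hZ', hαB, hαW]
    have hcomm : Commute B (B * Z ^ j * W ^ k) :=
      ((Commute.refl B).mul_right (hBZ.pow_right j)).mul_right (hBW.pow_right k)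
    -- For the odd element `y = B Zʲ Wᵏ`, which commutes with `B`, the graded trace property reads
    -- `T(B y) = -T(y B) = -T(B y)`, so `T(B y) = 0`.
    rw [hαy, neg_mul, ← hcomm.eq, map_neg, self_eq_neg] at h1
    have h2 : E * (Z ^ (j + 1) * W ^ k) =
        B * (B * Z ^ j * W ^ k) - E * (Z ^ j * W ^ (k + 1)) := by
      have hZB : Z ^ j * (B * B) = B * B * Z ^ j :=
        ((hBZ.mul_left hBZ).symm.pow_left j).eq
      have : Z ^ (j + 1) = B * B * Z ^ j - Z ^ j * W := by
        rw [pow_succ, ← hZB, ← mul_sub]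
      rw [this, pow_succ' W, sub_mul, mul_sub]
      simp only [← mul_assoc]
      rw [hEB']
    rw [h2, map_sub, h1, ih (k + 1), pow_succ, show j + 1 + k = j + (k + 1) by ring]
    ring

/-- The character of the cycle on an idempotent `e` is computed by the powers of `D²`. -/
lemma character_idempotent {e : A} (he : e * e = e) (hB : C.ι e * C.D * C.ι e ∈ C.N)
    (hBtr : ∀ y ∈ C.N, C.T (C.ι e * C.D * C.ι e * y) = C.T (C.α y * (C.ι e * C.D * C.ι e)))
    (hW : ∀ y ∈ C.N, C.D * C.D * y ∈ C.N) (n : ℕ) :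
    C.T (C.form fun _ : Fin (2 * n + 1) => e) =
      (-1) ^ n * C.T ((C.D * C.D) ^ n * C.ι e) := by
  have h1 : C.form (fun _ : Fin (2 * n + 1) => e) = C.ι e * C.d e ^ (2 * n) := by
    simp [form, forms, List.ofFn_const]
  have h2 := C.trace_corner_pow he hB hBtr hW n 0
  rw [h1, ι_mul_d_pow C he]
  rw [pow_zero, mul_one, add_zero] at h2
  rw [h2]
  congr 2
  have hEE : C.ι e * C.ι e = C.ι e := by rw [← map_mul, he]
  have hc : Commute (C.D * C.D) (C.ι e) := C.sq_comm e
  rw [hc.mul_pow, ← mul_assoc, ← (hc.pow_left n).eq, mul_assoc, ← pow_succ']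
  congr 1
  exact IsIdempotentElem.pow_succ_eq n hEE

end DiracCycle
end CyclicCohomology

/-! ### Grassmann algebra and Berezin integral. -/

namespace CyclicCohomology

section Grassmann

open scoped TensorProduct

/-- The Grassmann algebra on `m` generators. -/
abbrev Grassmann (m : ℕ) : Type := ExteriorAlgebra ℂ (Fin m → ℂ)

variable {m : ℕ}

/-- The generators of the Grassmann algebra. -/
noncomputable def theta (a : Fin m) : Grassmann m := ExteriorAlgebra.ι ℂ (Pi.single a 1)

/-- The parity automorphism of the Grassmann algebra. -/
noncomputable def parity : Grassmann m →ₐ[ℂ] Grassmann m := CliffordAlgebra.involute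

lemma parity_theta (a : Fin m) : parity (theta a) = -theta a := CliffordAlgebra.involute_ι _

lemma theta_anticomm (a b : Fin m) : theta a * theta b = -(theta b * theta a) :=
  eq_neg_of_add_eq_zero_left (ExteriorAlgebra.ι_add_mul_swap _ _)

lemma theta_sq (a : Fin m) : theta a * theta a = 0 := ExteriorAlgebra.ι_sq_zero _

lemma theta_mul (a : Fin m) (x : Grassmann m) : theta a * x = parity x * theta a := by
  induction x using ExteriorAlgebra.induction with
  | algebraMap r => rw [parity, AlgHom.commutes, Algebra.commutes]
  | ι v =>
    have h : parity (ExteriorAlgebra.ι ℂ v) = -ExteriorAlgebra.ι ℂ v := CliffordAlgebra.involute_ι _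
    rw [h, neg_mul]
    exact eq_neg_of_add_eq_zero_left (ExteriorAlgebra.ι_add_mul_swap _ _)
  | mul x y hx hy => rw [map_mul, ← mul_assoc, hx, mul_assoc, hy, mul_assoc]
  | add x y hx hy => rw [map_add, mul_add, add_mul, hx, hy]

/-- The Berezin integral. -/
noncomputable def berezin : Grassmann m →ₗ[ℂ] ℂ :=
  ExteriorAlgebra.liftAlternating fun i =>
    if h : i = m then h ▸ Matrix.detRowAlternating else 0

lemma berezin_prod (f : Fin m → Fin m) : berezin (List.ofFn fun i => theta (f i)).prod =
    Matrix.detRowAlternating fun i => (Pi.single (f i) 1 : Fin m → ℂ) := by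
  have : (List.ofFn fun i => theta (f i)).prod =
      ExteriorAlgebra.ιMulti ℂ m fun i => (Pi.single (f i) 1 : Fin m → ℂ) := by
    rw [ExteriorAlgebra.ιMulti_apply]; rfl
  rw [this, berezin, ExteriorAlgebra.liftAlternating_apply_ιMulti]
  simp

lemma berezin_perm (σ : Equiv.Perm (Fin m)) :
    berezin (List.ofFn fun i => theta (σ i)).prod = ((Equiv.Perm.sign σ : ℤ) : ℂ) := by
  rw [berezin_prod]
  have h := (Matrix.detRowAlternating (R := ℂ) (n := Fin m)).map_perm
    (fun i => (Pi.single i 1 : Fin m → ℂ)) σ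
  have h1 : Matrix.detRowAlternating (fun i => (Pi.single i 1 : Fin m → ℂ)) = 1 := by
    have : (fun i => (Pi.single i 1 : Fin m → ℂ)) = (1 : Matrix (Fin m) (Fin m) ℂ) := by
      ext i j; simp [Matrix.one_apply, Pi.single_apply, eq_comm]
    rw [this]; exact Matrix.det_one
  rw [h1] at h
  rw [show (fun i => (Pi.single (σ i) 1 : Fin m → ℂ)) = (fun i => Pi.single i 1) ∘ σ from rfl, h]
  simp [Units.smul_def]

lemma berezin_eq_zero {f : Fin m → Fin m} (hf : ¬ Function.Injective f) :
    berezin (List.ofFn fun i => theta (f i)).prod = 0 := by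
  rw [berezin_prod]
  apply AlternatingMap.map_eq_zero_of_not_injective
  intro h
  exact hf fun i j hij => h (by simp only [hij])

/-- A word with a repeated generator integrates to zero, so only permutations contribute. This is
how a product of one-forms becomes the antisymmetrized sum in `ω`. -/
lemma sum_berezin (g : (Fin m → Fin m) → ℂ) :
    ∑ f : Fin m → Fin m, berezin (List.ofFn fun i => theta (f i)).prod * g f =
      ∑ σ : Equiv.Perm (Fin m), ((Equiv.Perm.sign σ : ℤ) : ℂ) * g σ := by
  classical
  have h1 : ∀ σ : Equiv.Perm (Fin m), ((Equiv.Perm.sign σ : ℤ) : ℂ) * g σ =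
      berezin (List.ofFn fun i => theta ((σ : Fin m → Fin m) i)).prod * g σ := fun σ => by
    rw [berezin_perm]
  simp only [h1]
  symm
  refine Finset.sum_of_injOn (fun σ : Equiv.Perm (Fin m) => (σ : Fin m → Fin m))
    (fun σ _ τ _ h => DFunLike.coe_injective h) (fun _ _ => Finset.mem_coe.2 (Finset.mem_univ _))
    (fun f _ hf => ?_) (fun _ _ => rfl)
  rw [berezin_eq_zero, zero_mul]
  intro hinj
  exact hf ⟨Equiv.ofBijective f (Finite.injective_iff_bijective.1 hinj), by simp, rfl⟩

/-- Since `p k` squares to zero, the binomial expansion of `(s + p k)^(j+1)` stops after the linear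
term. The vanishing of the power `k + 1` is proved alongside because it removes the leading term in
the induction step. -/
lemma sum_pow_of_sq_zero {S : Type} [Ring S] (p : ℕ → S) (hp : ∀ i, p i * p i = 0)
    (hc : ∀ i j, Commute (p i) (p j)) (k : ℕ) :
    (∑ i ∈ Finset.range k, p i) ^ (k + 1) = 0 ∧
    (∑ i ∈ Finset.range k, p i) ^ k = (k.factorial : S) * ((List.range k).map p).prod := by
  induction k with
  | zero => simp
  | succ k ih =>
    set s := ∑ i ∈ Finset.range k, p i with hs
    have hcs : Commute s (p k) := Commute.sum_left _ _ _ fun i _ => hc i k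
    have h1 : ∀ j : ℕ, (s + p k) ^ (j + 1) = s ^ (j + 1) + ((j + 1 : ℕ) : S) * (s ^ j * p k) := by
      intro j
      induction j with
      | zero => simp
      | succ j ihj =>
        have e1 : s ^ j * p k * s = s ^ (j + 1) * p k := by
          rw [mul_assoc, ← hcs.eq, ← mul_assoc, ← pow_succ]
        have e2 : s ^ j * p k * p k = 0 := by rw [mul_assoc, hp, mul_zero]
        rw [pow_succ, ihj, add_mul, mul_add, mul_add, mul_assoc ((j + 1 : ℕ) : S),
          mul_assoc ((j + 1 : ℕ) : S), e1, e2, ← pow_succ]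
        push_cast
        noncomm_ring
    rw [Finset.sum_range_succ, ← hs]
    constructor
    · rw [h1, ih.1, pow_succ, ih.1]; simp
    · rw [h1, ih.1, ih.2, List.range_succ, List.map_append, List.prod_append, Nat.factorial_succ]
      simp [mul_assoc]

/-- The symplectic form `∑ⱼ θ_{2j} θ_{2j+1}`. -/
noncomputable def symplectic (n : ℕ) : Grassmann (2 * n) :=
  ∑ j : Fin n, theta ⟨2 * j, by omega⟩ * theta ⟨2 * j + 1, by omega⟩

/-- The pairs `θ_{2j} θ_{2j+1}` are even, hence commute, and square to zero. So the `n`-th power is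
`n!` times the product of all generators in increasing order, whose integral is `1`. -/
lemma berezin_symplectic_pow (n : ℕ) : berezin (symplectic n ^ n) = (n.factorial : ℂ) := by
  let p : ℕ → Grassmann (2 * n) := fun j => if h : j < n then
    theta ⟨2 * j, by omega⟩ * theta ⟨2 * j + 1, by omega⟩ else 0
  have hcomm : ∀ a b c d : Fin (2 * n), Commute (theta a * theta b) (theta c * theta d) := by
    intro a b c d
    rw [Commute, SemiconjBy, mul_assoc, theta_mul b, map_mul, parity_theta, parity_theta, neg_mul_neg,
      ← mul_assoc, theta_mul a, map_mul, parity_theta, parity_theta, neg_mul_neg, mul_assoc]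
  have hp : ∀ i, p i * p i = 0 := by
    intro i
    by_cases h : i < n
    · simp only [p, dif_pos h]
      rw [mul_assoc, ← mul_assoc (theta ⟨2 * i + 1, _⟩), theta_anticomm ⟨2 * i + 1, _⟩, neg_mul,
        mul_assoc, theta_sq]
      simp
    · simp [p, h]
  have hc : ∀ i j, Commute (p i) (p j) := by
    intro i j
    simp only [p]
    split_ifs
    exacts [hcomm _ _ _ _, Commute.zero_right _, Commute.zero_left _, Commute.zero_left _]
  have hs : symplectic n = ∑ i ∈ Finset.range n, p i := by
    rw [Finset.sum_range]
    exact Finset.sum_congr rfl fun i _ => by simp [p, i.2]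
  have hl : ((List.range n).map p).prod = (List.ofFn fun i : Fin (2 * n) => theta i).prod := by
    rw [List.ofFn_mul', List.prod_flatten, List.map_ofFn]
    congr 1
    apply List.ext_getElem
    · simp
    · intro i h1 h2
      have hi : i < n := by simpa using h1
      simp [p, hi, List.ofFn_succ]
  rw [hs, (sum_pow_of_sq_zero p hp hc n).2, hl]
  have h := berezin_perm (1 : Equiv.Perm (Fin (2 * n)))
  simp only [Equiv.Perm.one_apply, Equiv.Perm.sign_one, Units.val_one, Int.cast_one] at h
  rw [← nsmul_eq_mul, map_nsmul, h]
  simp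

end Grassmann

end CyclicCohomology

/-! ### The Dirac element of a family of multipliers with scalar commutators. -/

namespace CyclicCohomology

open scoped TensorProduct

/-- An algebra `A` acting through `ρ` on an algebra `R`, with multipliers `X₀, …, X_{m-1}` of `A`
whose commutators are scalars, and a trace on `A` invariant under these multipliers. -/
structure HeisenbergTrace (m : ℕ) (A R : Type) [NonUnitalRing A] [Module ℂ A] [Ring R]
    [Algebra ℂ R] where
  ρ : A →ₙₐ[ℂ] R
  X : Fin m → R
  c : Fin m → Fin m → ℂ
  comm : ∀ a b, X a * X b - X b * X a = algebraMap ℂ R (c a b)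
  left_mem : ∀ a s, ∃ t, X a * ρ s = ρ t
  right_mem : ∀ a s, ∃ t, ρ s * X a = ρ t
  τ : R →ₗ[ℂ] ℂ
  trace_mul : ∀ s t, τ (ρ s * ρ t) = τ (ρ t * ρ s)
  trace_comm : ∀ a s, τ (X a * ρ s) = τ (ρ s * X a)

namespace HeisenbergTrace

variable {m : ℕ} {A R : Type} [NonUnitalRing A] [Module ℂ A] [Ring R] [Algebra ℂ R]
  (H : HeisenbergTrace m A R)

/-- The Dirac element `∑ₐ θₐ ⊗ Xₐ`. -/
noncomputable def dirac : Grassmann m ⊗[ℂ] R := ∑ a, theta a ⊗ₜ H.X a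

/-- The curvature `½ ∑ c_{ab} θₐ θ_b`. -/
noncomputable def curv : Grassmann m := (2⁻¹ : ℂ) • ∑ a, ∑ b, H.c a b • (theta a * theta b)

/-- The products `θ_a θ_b` are antisymmetric, so averaging the double sum with its transpose leaves
only half the commutators `[X_a, X_b]`, which are scalars. -/
lemma dirac_sq : H.dirac * H.dirac = H.curv ⊗ₜ 1 := by
  have h1 : H.dirac * H.dirac = ∑ a, ∑ b, (theta a * theta b) ⊗ₜ[ℂ] (H.X a * H.X b) := by
    simp [dirac, Finset.sum_mul_sum]
  have h2 : H.dirac * H.dirac = -∑ a, ∑ b, (theta a * theta b) ⊗ₜ[ℂ] (H.X b * H.X a) := by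
    rw [h1, Finset.sum_comm, ← Finset.sum_neg_distrib]
    refine Finset.sum_congr rfl fun a _ => ?_
    rw [← Finset.sum_neg_distrib]
    refine Finset.sum_congr rfl fun b _ => ?_
    rw [theta_anticomm b a, TensorProduct.neg_tmul]
  have h3 : (2 : ℂ) • (H.dirac * H.dirac) = ∑ a, ∑ b, (H.c a b • (theta a * theta b)) ⊗ₜ[ℂ] 1 := by
    rw [two_smul]
    nth_rewrite 1 [h1]
    rw [h2, ← sub_eq_add_neg, ← Finset.sum_sub_distrib]
    refine Finset.sum_congr rfl fun a _ => ?_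
    rw [← Finset.sum_sub_distrib]
    refine Finset.sum_congr rfl fun b _ => ?_
    rw [← TensorProduct.tmul_sub, H.comm, Algebra.algebraMap_eq_smul_one, TensorProduct.tmul_smul,
      TensorProduct.smul_tmul']
  rw [curv, ← TensorProduct.smul_tmul', TensorProduct.sum_tmul]
  simp only [TensorProduct.sum_tmul]
  rw [← h3, smul_smul]
  simp

/-- The graded trace: Berezin integral tensor trace. -/
noncomputable def superTrace : Grassmann m ⊗[ℂ] R →ₗ[ℂ] ℂ :=
  LinearMap.mul' ℂ ℂ ∘ₗ TensorProduct.map berezin H.τ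

lemma superTrace_tmul (x : Grassmann m) (r : R) :
    H.superTrace (x ⊗ₜ r) = berezin x * H.τ r := by simp [superTrace]

/-- The image of `Λ ⊗ A` in `Λ ⊗ R`. -/
noncomputable def formSpace : Submodule ℂ (Grassmann m ⊗[ℂ] R) :=
  Submodule.span ℂ {z | ∃ (x : Grassmann m) (s : A), z = x ⊗ₜ H.ρ s}

lemma tmul_mem (x : Grassmann m) (s : A) : x ⊗ₜ H.ρ s ∈ H.formSpace :=
  Submodule.subset_span ⟨x, s, rfl⟩

/-- Two linear maps that agree on `x ⊗ ρ s` agree on the form space. -/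
lemma eq_on_formSpace {M : Type} [AddCommGroup M] [Module ℂ M] {f g : Grassmann m ⊗[ℂ] R →ₗ[ℂ] M}
    (h : ∀ x s, f (x ⊗ₜ H.ρ s) = g (x ⊗ₜ H.ρ s)) {y : Grassmann m ⊗[ℂ] R}
    (hy : y ∈ H.formSpace) : f y = g y := by
  refine LinearMap.eqOn_span (s := {z | ∃ (x : Grassmann m) (s : A), z = x ⊗ₜ H.ρ s}) ?_ hy
  rintro _ ⟨x, s, rfl⟩
  exact h x s

/-- The parity automorphism of `Λ ⊗ R`. -/
noncomputable def grading (m : ℕ) (R : Type) [Ring R] [Algebra ℂ R] :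
    Grassmann m ⊗[ℂ] R →ₐ[ℂ] Grassmann m ⊗[ℂ] R :=
  Algebra.TensorProduct.map parity (AlgHom.id ℂ R)

lemma grading_tmul (x : Grassmann m) (r : R) : grading m R (x ⊗ₜ r) = parity x ⊗ₜ r := by
  simp [grading]

lemma mem_mul {x y : Grassmann m ⊗[ℂ] R} (hx : x ∈ H.formSpace) (hy : y ∈ H.formSpace) :
    x * y ∈ H.formSpace := by
  refine Submodule.span_induction (p := fun x _ => x * y ∈ H.formSpace) ?_ (by simp)
    (fun a b _ _ ha hb => by rw [add_mul]; exact add_mem ha hb)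
    (fun c a _ ha => by rw [smul_mul_assoc]; exact Submodule.smul_mem _ c ha) hx
  rintro _ ⟨u, s, rfl⟩
  refine Submodule.span_induction (p := fun y _ => u ⊗ₜ H.ρ s * y ∈ H.formSpace) ?_ (by simp)
    (fun a b _ _ ha hb => by rw [mul_add]; exact add_mem ha hb)
    (fun c a _ ha => by rw [mul_smul_comm]; exact Submodule.smul_mem _ c ha) hy
  rintro _ ⟨v, t, rfl⟩
  rw [Algebra.TensorProduct.tmul_mul_tmul, ← map_mul]
  exact H.tmul_mem _ _

lemma tmul_one_mul_mem (u : Grassmann m) {y : Grassmann m ⊗[ℂ] R} (hy : y ∈ H.formSpace) :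
    u ⊗ₜ 1 * y ∈ H.formSpace := by
  refine Submodule.span_induction (p := fun y _ => u ⊗ₜ 1 * y ∈ H.formSpace) ?_ (by simp)
    (fun a b _ _ ha hb => by rw [mul_add]; exact add_mem ha hb)
    (fun c a _ ha => by rw [mul_smul_comm]; exact Submodule.smul_mem _ c ha) hy
  rintro _ ⟨v, t, rfl⟩
  rw [Algebra.TensorProduct.tmul_mul_tmul, one_mul]
  exact H.tmul_mem _ _

lemma exists_bracket (a : Fin m) (s : A) : ∃ t, H.X a * H.ρ s - H.ρ s * H.X a = H.ρ t := by
  obtain ⟨t, ht⟩ := H.left_mem a s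
  obtain ⟨u, hu⟩ := H.right_mem a s
  exact ⟨t - u, by rw [ht, hu, map_sub]⟩

/-- Supertrace property for one-forms. -/
lemma superTrace_oneForm (t : Fin m → A) {y : Grassmann m ⊗[ℂ] R} (hy : y ∈ H.formSpace) :
    H.superTrace ((∑ a, theta a ⊗ₜ H.ρ (t a)) * y) =
      H.superTrace (grading m R y * ∑ a, theta a ⊗ₜ H.ρ (t a)) := by
  refine H.eq_on_formSpace
    (f := H.superTrace ∘ₗ LinearMap.mulLeft ℂ (∑ a, theta a ⊗ₜ H.ρ (t a)))
    (g := H.superTrace ∘ₗ LinearMap.mulRight ℂ (∑ a, theta a ⊗ₜ H.ρ (t a)) ∘ₗ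
      (grading m R).toLinearMap) (fun x s => ?_) hy
  simp [Finset.sum_mul, Finset.mul_sum, grading_tmul, superTrace_tmul, theta_mul, H.trace_mul]

/-- The cycle over `A` given by the Grassmann-valued commutator with the Dirac element. -/
noncomputable def cycle : DiracCycle A (Grassmann m ⊗[ℂ] R) where
  ι := (Algebra.TensorProduct.includeRight : R →ₐ[ℂ] Grassmann m ⊗[ℂ] R).toNonUnitalAlgHom.comp H.ρ
  α := grading m R
  D := H.dirac
  T := H.superTrace
  N := H.formSpace
  α_ι a := by
    change grading m R (1 ⊗ₜ H.ρ a) = 1 ⊗ₜ H.ρ a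
    simp [grading_tmul]
  α_D := by simp [dirac, grading_tmul, parity_theta, TensorProduct.neg_tmul]
  sq_comm a := by
    change _ * (1 ⊗ₜ H.ρ a) = (1 ⊗ₜ H.ρ a) * _
    simp [H.dirac_sq]
  mul_mem := H.mem_mul
  ι_mem a := H.tmul_mem 1 a
  d_mem s := by
    choose t ht using fun a => H.exists_bracket a s
    have : H.dirac * ((1 : Grassmann m) ⊗ₜ[ℂ] H.ρ s) - (1 : Grassmann m) ⊗ₜ[ℂ] H.ρ s * H.dirac =
        ∑ a, theta a ⊗ₜ H.ρ (t a) := by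
      simp [dirac, Finset.sum_mul, Finset.mul_sum, ← ht, TensorProduct.tmul_sub]
    exact this ▸ Submodule.sum_mem _ fun a _ => H.tmul_mem _ _
  trace_even s y hy := by
    refine H.eq_on_formSpace (f := H.superTrace ∘ₗ LinearMap.mulLeft ℂ (1 ⊗ₜ H.ρ s))
      (g := H.superTrace ∘ₗ LinearMap.mulRight ℂ (1 ⊗ₜ H.ρ s)) (fun x t => ?_) hy
    simp [superTrace_tmul, H.trace_mul]
  trace_d s y hy := by
    choose t ht using fun a => H.exists_bracket a s
    have : H.dirac * ((1 : Grassmann m) ⊗ₜ[ℂ] H.ρ s) - (1 : Grassmann m) ⊗ₜ[ℂ] H.ρ s * H.dirac =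
        ∑ a, theta a ⊗ₜ H.ρ (t a) := by
      simp [dirac, Finset.sum_mul, Finset.mul_sum, ← ht, TensorProduct.tmul_sub]
    have h2 := H.superTrace_oneForm t hy
    rw [← this] at h2
    exact h2
  closed y hy := by
    refine H.eq_on_formSpace (f := H.superTrace ∘ₗ LinearMap.mulLeft ℂ H.dirac)
      (g := H.superTrace ∘ₗ LinearMap.mulRight ℂ H.dirac ∘ₗ (grading m R).toLinearMap)
      (fun x t => ?_) hy
    simp [dirac, Finset.sum_mul, Finset.mul_sum, grading_tmul, superTrace_tmul, theta_mul,
      H.trace_comm]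

lemma cycle_ι (s : A) : H.cycle.ι s = 1 ⊗ₜ H.ρ s := rfl

lemma cycle_D : H.cycle.D = H.dirac := rfl

lemma cycle_T : H.cycle.T = H.superTrace := rfl

lemma cycle_d (s : A) : H.cycle.d s = ∑ a, theta a ⊗ₜ (H.X a * H.ρ s - H.ρ s * H.X a) := by
  rw [DiracCycle.d_apply, cycle_ι, cycle_D]
  simp [dirac, Finset.sum_mul, Finset.mul_sum, TensorProduct.tmul_sub]

lemma tmul_list_prod {k : ℕ} (x : Fin k → Grassmann m) (r : Fin k → R) :
    (List.ofFn fun i => x i ⊗ₜ[ℂ] r i).prod = (List.ofFn x).prod ⊗ₜ (List.ofFn r).prod := by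
  induction k with
  | zero => simp [Algebra.TensorProduct.one_def]
  | succ k ih => simp [List.ofFn_succ, ih]

/-- The character of the cycle as an antisymmetrized trace. -/
lemma character_eq (s : Fin (m + 1) → A) : H.cycle.character m s =
    ∑ σ : Equiv.Perm (Fin m), ((Equiv.Perm.sign σ : ℤ) : ℂ) * H.τ (H.ρ (s 0) *
      (List.ofFn fun i : Fin m => H.X (σ i) * H.ρ (s i.succ) - H.ρ (s i.succ) * H.X (σ i)).prod) := by
  -- Expands the product of one-forms into a sum over all functions choosing one generator per
  -- factor.
  have h := (MultilinearMap.mkPiAlgebraFin ℂ m (Grassmann m ⊗[ℂ] R)).map_sum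
    fun (i a : Fin m) => theta a ⊗ₜ[ℂ] (H.X a * H.ρ (s i.succ) - H.ρ (s i.succ) * H.X a)
  simp only [MultilinearMap.mkPiAlgebraFin_apply, tmul_list_prod] at h
  rw [DiracCycle.character_apply, DiracCycle.form, DiracCycle.forms, cycle_ι, cycle_T]
  simp only [cycle_d]
  rw [h, Finset.mul_sum, map_sum, ← sum_berezin fun f => H.τ (H.ρ (s 0) *
      (List.ofFn fun i : Fin m => H.X (f i) * H.ρ (s i.succ) - H.ρ (s i.succ) * H.X (f i)).prod)]
  refine Finset.sum_congr rfl fun f _ => ?_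
  rw [Algebra.TensorProduct.tmul_mul_tmul, one_mul, superTrace_tmul]

end HeisenbergTrace

/-- The character on an idempotent. -/
lemma HeisenbergTrace.character_idempotent {n : ℕ} {A R : Type} [NonUnitalRing A] [Module ℂ A]
    [Ring R] [Algebra ℂ R] (H : HeisenbergTrace (2 * n) A R) {e : A} (he : e * e = e) :
    H.cycle.character (2 * n) (fun _ => e) = (-1) ^ n * (berezin (H.curv ^ n) * H.τ (H.ρ e)) := by
  -- Although `D` has unbounded coefficients in the intended example, `eDe` is a genuine one-form:
  -- its coefficients `e X_a e` lie in the algebra because `X_a e` does. This makes the graded trace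
  -- property available for it.
  obtain ⟨t, ht⟩ : ∃ t : Fin (2 * n) → A, H.cycle.ι e * H.cycle.D * H.cycle.ι e =
      ∑ a, theta a ⊗ₜ H.ρ (t a) := by
    choose t ht using fun a => H.left_mem a e
    refine ⟨fun a => e * t a, ?_⟩
    simp [H.cycle_ι, H.cycle_D, dirac, Finset.sum_mul, Finset.mul_sum, ← ht, mul_assoc]
  rw [DiracCycle.character_apply, DiracCycle.character_idempotent H.cycle he, H.cycle_D, H.dirac_sq,
    H.cycle_ι, H.cycle_T, Algebra.TensorProduct.tmul_pow, Algebra.TensorProduct.tmul_mul_tmul,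
    superTrace_tmul]
  · simp
  · rw [ht]
    exact Submodule.sum_mem _ fun a _ => H.tmul_mem _ _
  · intro y hy
    rw [ht]
    exact H.superTrace_oneForm t hy
  · intro y hy
    rw [H.cycle_D, H.dirac_sq]
    exact H.tmul_one_mul_mem _ hy

end CyclicCohomology

/-! ### Passage to matrices. -/

namespace CyclicCohomology

section Paths

variable {k : ℕ}

/-- Expansion over index paths from `p` to `q` with intermediate vertices `i`: `Fin.cons p i` lists
the sources of the steps and `Fin.snoc i q` their targets. -/
lemma list_prod_matrix_apply {R : Type} [Ring R] {m : ℕ} (N : Fin (m + 1) → Matrix (Fin k) (Fin k) R)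
    (p q : Fin k) : (List.ofFn N).prod p q = ∑ i : Fin m → Fin k,
      (List.ofFn fun j : Fin (m + 1) =>
        N j (Fin.cons (α := fun _ => Fin k) p i j) (Fin.snoc (α := fun _ => Fin k) i q j)).prod := by
  induction m generalizing p with
  | zero => simp [List.ofFn_succ, Fin.snoc]
  | succ m ih =>
    rw [List.ofFn_succ, List.prod_cons, Matrix.mul_apply,
      ← (Fin.consEquiv fun _ : Fin (m + 1) => Fin k).sum_comp, Fintype.sum_prod_type]
    refine Finset.sum_congr rfl fun r _ => ?_
    rw [ih, Finset.mul_sum]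
    refine Finset.sum_congr rfl fun i _ => ?_
    have hs : (Fin.snoc (Fin.consEquiv (fun _ : Fin (m + 1) => Fin k) (r, i)) q :
        Fin (m + 2) → Fin k) = Fin.cons r (Fin.snoc i q : Fin (m + 1) → Fin k) :=
      (Fin.cons_snoc_eq_snoc_cons (β := Fin k) r i q).symm
    rw [hs]
    conv_rhs => rw [List.ofFn_succ, List.prod_cons]
    simp only [Fin.cons_zero, Fin.cons_succ, Fin.consEquiv_apply]

/-- The trace sums over closed paths; addition in `Fin (m + 1)` wraps around and closes the path. -/
lemma trace_list_prod {R : Type} [Ring R] {m : ℕ} (N : Fin (m + 1) → Matrix (Fin k) (Fin k) R) :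
    (List.ofFn N).prod.trace = ∑ i : Fin (m + 1) → Fin k,
      (List.ofFn fun j : Fin (m + 1) => N j (i j) (i (j + 1))).prod := by
  rw [Matrix.trace, ← (Fin.consEquiv fun _ : Fin (m + 1) => Fin k).sum_comp, Fintype.sum_prod_type]
  refine Finset.sum_congr rfl fun p _ => ?_
  rw [Matrix.diag_apply, list_prod_matrix_apply]
  refine Finset.sum_congr rfl fun i _ => ?_
  congr 2
  funext j
  congr 1
  induction j using Fin.lastCases with
  | last => simp [Fin.consEquiv_apply]
  | cast j => rw [Fin.coeSucc_eq_succ]; simp [Fin.consEquiv_apply]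

end Paths

namespace HeisenbergTrace

variable {m : ℕ} {A R : Type} [NonUnitalRing A] [Module ℂ A] [Ring R] [Algebra ℂ R]
  (H : HeisenbergTrace m A R)

/-- Extension of the data to matrices. -/
noncomputable def matrix (k : ℕ) :
    HeisenbergTrace m (Matrix (Fin k) (Fin k) A) (Matrix (Fin k) (Fin k) R) where
  ρ :=
    { toFun := fun M => M.map H.ρ
      map_smul' := fun c M => by ext; simp
      map_zero' := by ext; simp
      map_add' := fun M N => by ext; simp
      map_mul' := fun M N => by ext; simp [Matrix.mul_apply] }
  X a := Matrix.diagonal fun _ => H.X a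
  c := H.c
  comm a b := by
    rw [Matrix.diagonal_mul_diagonal, Matrix.diagonal_mul_diagonal, Matrix.diagonal_sub]
    simp only [H.comm]
    rfl
  left_mem a M := by
    choose t ht using fun s => H.left_mem a s
    exact ⟨M.map t, by ext i j; simp [ht]⟩
  right_mem a M := by
    choose t ht using fun s => H.right_mem a s
    exact ⟨M.map t, by ext i j; simp [ht]⟩
  τ := H.τ ∘ₗ Matrix.traceLinearMap (Fin k) ℂ R
  trace_mul M N := by
    simp only [LinearMap.comp_apply, Matrix.traceLinearMap_apply, Matrix.trace, Matrix.diag_apply,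
      Matrix.mul_apply, map_sum]
    rw [Finset.sum_comm]
    exact Finset.sum_congr rfl fun i _ => Finset.sum_congr rfl fun j _ => H.trace_mul _ _
  trace_comm a M := by
    simp [Matrix.trace, H.trace_comm]

lemma matrix_curv (k : ℕ) : (H.matrix k).curv = H.curv := rfl

lemma matrix_τ {k : ℕ} (M : Matrix (Fin k) (Fin k) A) :
    (H.matrix k).τ ((H.matrix k).ρ M) = ∑ i, H.τ (H.ρ (M i i)) := by
  change H.τ (Matrix.trace ((H.matrix k).ρ M)) = _
  rw [Matrix.trace, map_sum]
  rfl

/-- The multipliers act on matrices as scalar diagonals, so commutators are taken entrywise and the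
sum over closed index paths is a matrix trace. Thus idempotent matrices reduce to idempotents of a
single algebra. -/
lemma cupTr_character {k : ℕ} (M : Fin (m + 1) → Matrix (Fin k) (Fin k) A) :
    cupTr (H.cycle.character m) M = (H.matrix k).cycle.character m M := by
  rw [character_eq, cupTr]
  simp only [character_eq]
  rw [Finset.sum_comm]
  refine Finset.sum_congr rfl fun σ _ => ?_
  rw [← Finset.mul_sum, ← map_sum]
  congr 1
  let N : Fin (m + 1) → Matrix (Fin k) (Fin k) R := Fin.cons ((H.matrix k).ρ (M 0)) fun i =>
    (H.matrix k).X (σ i) * (H.matrix k).ρ (M i.succ) - (H.matrix k).ρ (M i.succ) * (H.matrix k).X (σ i)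
  have h := trace_list_prod N
  change _ = H.τ (Matrix.trace (_ : Matrix (Fin k) (Fin k) R))
  congr 1
  rw [List.ofFn_succ, List.prod_cons] at h
  simp only [N, Fin.cons_zero, Fin.cons_succ] at h
  rw [h]
  refine Finset.sum_congr rfl fun i _ => ?_
  rw [List.ofFn_succ, List.prod_cons]
  simp only [Fin.cons_zero, Fin.cons_succ]
  congr 3
  funext j
  change _ = (Matrix.diagonal (fun _ => H.X (σ j)) * (M j.succ).map H.ρ -
    (M j.succ).map H.ρ * Matrix.diagonal (fun _ => H.X (σ j)) : Matrix (Fin k) (Fin k) R) _ _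
  simp

end HeisenbergTrace

/-! ### Dependence of the pairing only on the classes in cyclic cohomology and `K₀`. -/

section Invariance

variable {A : Type} [NonUnitalRing A] [Module ℂ A]

lemma cupTr_rotate {m k : ℕ} (ψ : Cochain A m) (e : Matrix (Fin k) (Fin k) A) :
    ∑ i : Fin (m + 1) → Fin k, ψ (fun j => e (i (j - 1)) (i j)) = cupTr ψ fun _ => e := by
  rw [cupTr, ← (Equiv.arrowCongr (Equiv.addRight (-1 : Fin (m + 1))) (Equiv.refl (Fin k))).sum_comp]
  refine Finset.sum_congr rfl fun i _ => ?_
  congr 1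
  funext j
  simp [Equiv.arrowCongr, sub_eq_add_neg]

/-- Rotating the arguments changes the sign in odd degree, while the sum over closed paths with all
matrices equal is invariant under rotation. -/
lemma cupTr_eq_zero_of_odd {m k : ℕ} (hm : Odd m) {ψ : Cochain A m} (hψ : IsCyclic ψ)
    (e : Matrix (Fin k) (Fin k) A) : (cupTr ψ fun _ => e) = 0 := by
  have h : (cupTr ψ fun _ => e) = -cupTr ψ fun _ => e := by
    conv_lhs => rw [cupTr]
    rw [← cupTr_rotate, ← Finset.sum_neg_distrib]
    refine Finset.sum_congr rfl fun i _ => ?_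
    rw [hψ, hm.neg_one_pow]
    simp
  exact self_eq_neg.1 h

/-- Summing over the index shared by the two contracted factors, in position `r.succ`, forms the
matrix product `e * e = e` inside one slot of `ψ`. -/
lemma sum_contractNth_idempotent {m k : ℕ} (ψ : Cochain A m) {e : Matrix (Fin k) (Fin k) A}
    (he : IsIdempotentElem e) (r : Fin (m + 1)) :
    ∑ i : Fin (m + 2) → Fin k,
      ψ (Fin.contractNth r.castSucc (· * ·) fun j => e (i j) (i (j + 1))) =
      cupTr ψ fun _ => e := by
  rw [cupTr, ← (Fin.insertNthEquiv (fun _ : Fin (m + 2) => Fin k) r.succ).sum_comp,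
    Fintype.sum_prod_type, Finset.sum_comm]
  refine Finset.sum_congr rfl fun i _ => ?_
  have h1 : ∀ q : Fin k, (Fin.contractNth r.castSucc (· * ·) fun j =>
      e (Fin.insertNthEquiv (fun _ : Fin (m + 2) => Fin k) r.succ (q, i) j)
        (Fin.insertNthEquiv (fun _ : Fin (m + 2) => Fin k) r.succ (q, i) (j + 1))) =
      Function.update (fun j => e (i j) (i (j + 1))) r (e (i r) q * e q (i (r + 1))) := by
    intro q
    set I : Fin (m + 2) → Fin k := Fin.insertNthEquiv (fun _ : Fin (m + 2) => Fin k) r.succ (q, i)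
      with hI
    have hq : I r.succ = q := by simp [hI]
    have hs : ∀ j, I (r.succ.succAbove j) = i j := fun j => by simp [hI]
    have hle : ∀ j, j ≤ r → I j.castSucc = i j := fun j hj => by
      rw [← hs, Fin.succAbove_of_castSucc_lt _ _ (Fin.castSucc_lt_succ_iff.2 hj)]
    have hlt : ∀ j, r < j → I j.succ = i j := fun j hj => by
      rw [← hs, Fin.succAbove_of_le_castSucc]
      exact Fin.succ_le_castSucc_iff.2 hj
    -- For `j` the last index both sides wrap around to vertex `0`, which the insertion at a
    -- successor position leaves in place.
    have hnext : ∀ j, r ≤ j → I (j.succ + 1) = i (j + 1) := by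
      intro j hj
      induction j using Fin.lastCases with
      | last =>
        rw [Fin.succ_last, Fin.last_add_one, Fin.last_add_one, ← Fin.castSucc_zero]
        exact hle _ (Fin.zero_le _)
      | cast j =>
        rw [Fin.succ_castSucc, Fin.coeSucc_eq_succ, Fin.coeSucc_eq_succ]
        exact hlt _ (lt_of_le_of_lt hj Fin.castSucc_lt_succ)
    funext j
    rcases lt_trichotomy j r with h | h | h
    · rw [Fin.contractNth_apply_of_lt _ _ _ _ (by simpa using h), Function.update_of_ne h.ne,
        hle j h.le, Fin.coeSucc_eq_succ]
      congr 1
      have hj : j ≠ Fin.last m := (lt_of_lt_of_le h (Fin.le_last r)).ne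
      obtain ⟨j, rfl⟩ := Fin.exists_castSucc_eq.2 hj
      rw [Fin.succ_castSucc, Fin.coeSucc_eq_succ]
      exact hle _ (Fin.le_def.2 (Fin.lt_def.1 h))
    · subst h
      rw [Fin.contractNth_apply_of_eq _ _ _ _ (by simp), Function.update_self, hle j le_rfl,
        Fin.coeSucc_eq_succ, hq, hnext j le_rfl]
    · rw [Fin.contractNth_apply_of_gt _ _ _ _ (by simpa using h), Function.update_of_ne h.ne',
        hlt j h, hnext j h.le]
  simp only [h1]
  rw [← MultilinearMap.map_update_sum, ← Matrix.mul_apply, he.eq, Function.update_eq_self]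

/-- The same contraction for the wrap-around term: the shared index is now vertex `0`, and the
remaining path appears shifted by one, hence the comparison through `cupTr_rotate`. -/
lemma sum_cyclic_idempotent {m k : ℕ} (ψ : Cochain A m) {e : Matrix (Fin k) (Fin k) A}
    (he : IsIdempotentElem e) :
    ∑ i : Fin (m + 2) → Fin k,
      ψ (fun j => if j = 0 then e (i (Fin.last (m + 1))) (i (Fin.last (m + 1) + 1)) *
        e (i 0) (i (0 + 1)) else e (i j.castSucc) (i (j.castSucc + 1))) =
      cupTr ψ fun _ => e := by
  rw [← cupTr_rotate, ← (Fin.consEquiv (fun _ : Fin (m + 2) => Fin k)).sum_comp,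
    Fintype.sum_prod_type, Finset.sum_comm]
  refine Finset.sum_congr rfl fun i _ => ?_
  have h1 : ∀ q : Fin k, (fun j : Fin (m + 1) => if j = 0 then
      e (Fin.consEquiv (fun _ : Fin (m + 2) => Fin k) (q, i) (Fin.last (m + 1)))
        (Fin.consEquiv (fun _ : Fin (m + 2) => Fin k) (q, i) (Fin.last (m + 1) + 1)) *
      e (Fin.consEquiv (fun _ : Fin (m + 2) => Fin k) (q, i) 0)
        (Fin.consEquiv (fun _ : Fin (m + 2) => Fin k) (q, i) (0 + 1)) else
      e (Fin.consEquiv (fun _ : Fin (m + 2) => Fin k) (q, i) j.castSucc)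
        (Fin.consEquiv (fun _ : Fin (m + 2) => Fin k) (q, i) (j.castSucc + 1))) =
      Function.update (fun j => e (i (j - 1)) (i j)) 0 (e (i (0 - 1)) q * e q (i 0)) := by
    intro q
    set I : Fin (m + 2) → Fin k := Fin.consEquiv (fun _ : Fin (m + 2) => Fin k) (q, i) with hI
    have h0 : I 0 = q := by simp [hI]
    have hs : ∀ j : Fin (m + 1), I j.succ = i j := fun j => by simp [hI]
    have e0 : (0 : Fin (m + 1)) - 1 = Fin.last m := by rw [sub_eq_iff_eq_add, Fin.last_add_one]
    funext j
    by_cases hj : j = 0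
    · subst hj
      rw [if_pos rfl, Function.update_self, Fin.last_add_one, h0, e0, ← hs, ← hs, zero_add,
        Fin.succ_last, Fin.succ_zero_eq_one]
    · rw [if_neg hj, Function.update_of_ne hj, Fin.coeSucc_eq_succ, hs]
      obtain ⟨j, rfl⟩ := Fin.exists_succ_eq.2 hj
      obtain - | m := m
      · exact j.elim0
      have e1 : j.succ - 1 = j.castSucc := by rw [sub_eq_iff_eq_add, Fin.coeSucc_eq_succ]
      rw [e1]
      exact congrArg (e · _) (hs j.castSucc)
  simp only [h1]
  rw [← MultilinearMap.map_update_sum, ← Matrix.mul_apply, he.eq]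
  exact congrArg ψ (Function.update_eq_self (f := fun j => e (i (j - 1)) (i j)) 0)

/-- The Hochschild coboundary of a cyclic cochain of odd degree vanishes on idempotents. -/
lemma sum_hochschildB_idempotent {m k : ℕ} (hm : Odd m) {ψ : Cochain A m} (hψ : IsCyclic ψ)
    {e : Matrix (Fin k) (Fin k) A} (he : IsIdempotentElem e) :
    ∑ i : Fin (m + 2) → Fin k, hochschildB ψ (fun j => e (i j) (i (j + 1))) = 0 := by
  simp only [hochschildB, Finset.sum_add_distrib]
  rw [Finset.sum_comm]
  simp only [← Finset.mul_sum, sum_contractNth_idempotent ψ he, sum_cyclic_idempotent ψ he,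
    cupTr_eq_zero_of_odd hm hψ]
  simp

/-- The pairing with an idempotent depends only on the cyclic cohomology class. -/
lemma cupTr_eq_of_HC_eq {l k : ℕ} {φ φ' : cocycles A (2 * l)} (h : HC.mk φ = HC.mk φ')
    {e : Matrix (Fin k) (Fin k) A} (he : IsIdempotentElem e) :
    (cupTr φ.1 fun _ => e) = cupTr φ'.1 fun _ => e := by
  have h1 : φ - φ' ∈ coboundaries A (2 * l) := (Submodule.Quotient.eq _).1 h
  obtain - | l := l
  · have h2 : φ - φ' = 0 := h1
    rw [sub_eq_zero.1 h2]
  · obtain ⟨ψ, hψ, hφ⟩ : ∃ ψ : Cochain A (2 * l + 1), IsCyclic ψ ∧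
      ∀ a, (φ - φ').1 a = hochschildB ψ a := h1
    have h3 := sum_hochschildB_idempotent (m := 2 * l + 1) ⟨l, rfl⟩ hψ he
    rw [← sub_eq_zero, cupTr, cupTr, ← Finset.sum_sub_distrib, ← h3]
    exact Finset.sum_congr rfl fun i _ => hφ _

/-- A trace takes the same value on idempotents with the same class in `K₀`. -/
lemma trace_eq_of_sameK0Class [IsScalarTower ℂ A A] [SMulCommClass ℂ A A] {k l : ℕ}
    {e : Matrix (Fin k) (Fin k) A} {f : Matrix (Fin l) (Fin l) A} (h : SameK0Class e f)
    (t : A →ₗ[ℂ] ℂ) (ht : ∀ a b, t (a * b) = t (b * a)) : ∑ i, t (e i i) = ∑ i, t (f i i) := by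
  obtain ⟨r, u, v, huv, hvu⟩ := h
  -- Extending `t` by zero on scalars is still a trace on the unitization, and it ignores the
  -- identity blocks added for stabilization.
  have h1 : ∀ x y : Unitization ℂ A, t (x * y).snd = t (y * x).snd := by
    intro x y
    simp only [Unitization.snd_mul, map_add, map_smul, ht x.snd]
    ring
  have h2 : ∑ i, t ((u * v) i i).snd = ∑ j, t ((v * u) j j).snd := by
    have hs : ∀ {ι : Type} (s : Finset ι) (g : ι → Unitization ℂ A),
        t (∑ i ∈ s, g i).snd = ∑ i ∈ s, t (g i).snd := fun s g =>
      map_sum (t.toAddMonoidHom.comp (Unitization.sndHom ℂ ℂ A).toAddMonoidHom) g s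
    simp only [Matrix.mul_apply, hs]
    rw [Finset.sum_comm]
    exact Finset.sum_congr rfl fun i _ => Finset.sum_congr rfl fun j _ => h1 _ _
  rw [huv, hvu] at h2
  simpa using h2

end Invariance

/-- Each conjugate pair contributes twice, since both the commutator and the product of generators
change sign on exchange; this cancels the factor `½`. -/
lemma HeisenbergTrace.curv_eq_symplectic {n : ℕ} {A R : Type} [NonUnitalRing A] [Module ℂ A]
    [Ring R] [Algebra ℂ R] (H : HeisenbergTrace (2 * n) A R)
    (h0 : ∀ i j : Fin n, H.c ⟨2 * i, by omega⟩ ⟨2 * j, by omega⟩ = 0)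
    (h1 : ∀ i j : Fin n, H.c ⟨2 * i + 1, by omega⟩ ⟨2 * j + 1, by omega⟩ = 0)
    (h2 : ∀ i j : Fin n, H.c ⟨2 * i, by omega⟩ ⟨2 * j + 1, by omega⟩ = if i = j then 1 else 0)
    (h3 : ∀ i j : Fin n, H.c ⟨2 * i + 1, by omega⟩ ⟨2 * j, by omega⟩ = if i = j then -1 else 0) :
    H.curv = symplectic n := by
  have key : ∀ {M : Type} [AddCommMonoid M] (f : Fin (2 * n) → M),
      ∑ a, f a = ∑ j : Fin n, (f ⟨2 * j, by omega⟩ + f ⟨2 * j + 1, by omega⟩) := by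
    intro M _ f
    let E : Fin n × Fin 2 ≃ Fin (2 * n) := finProdFinEquiv.trans (finCongr (mul_comm n 2))
    rw [← E.sum_comp, Fintype.sum_prod_type]
    refine Finset.sum_congr rfl fun j _ => ?_
    rw [Fin.sum_univ_two]
    congr 2 <;> exact Fin.ext (by simp [E, add_comm])
  rw [curv, key]
  simp only [key, h0, h1, h2, h3]
  simp only [zero_smul, zero_add, add_zero, ite_smul, one_smul, Finset.sum_ite_eq, Finset.mem_univ,
    if_true, neg_smul]
  rw [symplectic, Finset.smul_sum]
  refine Finset.sum_congr rfl fun j _ => ?_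
  rw [theta_anticomm ⟨2 * j + 1, _⟩, neg_neg, ← two_smul ℂ, smul_smul]
  simp

end CyclicCohomology

/-! ### Operators with Schwartz kernels are of trace class. -/

namespace SmoothingOps

/-- Orthonormal vectors are at distance `√2`, so balls of radius `1/2` around them are disjoint.
Countability is needed to interchange the trace series with an integral. -/
lemma countable_of_orthonormal {E ι : Type} [NormedAddCommGroup E] [InnerProductSpace ℂ E]
    [TopologicalSpace.SeparableSpace E] {v : ι → E} (hv : Orthonormal ℂ v) : Countable ι := by
  refine Pairwise.countable_of_isOpen_disjoint (s := fun i => Metric.ball (v i) (1 / 2))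
    (fun i j hij => Metric.ball_disjoint_ball ?_) (fun i => Metric.isOpen_ball)
    fun i => ⟨v i, Metric.mem_ball_self (by norm_num)⟩
  have h : ‖v i - v j‖ * ‖v i - v j‖ = 1 * 1 + 1 * 1 := by
    rw [norm_sub_mul_self (𝕜 := ℂ), hv.1 i, hv.1 j, hv.2 hij]
    simp
  rw [dist_eq_norm]
  nlinarith [norm_nonneg (v i - v j)]

variable {n : ℕ}

instance : TopologicalSpace.SeparableSpace (L2 n) :=
  haveI : Fact ((2 : ENNReal) ≠ ⊤) := ⟨by norm_num⟩
  inferInstance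

lemma summable_integral_of_sum_le {Z ι : Type} [MeasurableSpace Z] {ν : Measure Z} {F : ι → Z → ℂ}
    (hF : ∀ i, Integrable (F i) ν) {B : Z → ℝ} (hB : Integrable B ν)
    (h : ∀ (s : Finset ι) z, ∑ i ∈ s, ‖F i z‖ ≤ B z) : Summable fun i => ∫ z, ‖F i z‖ ∂ν := by
  refine summable_of_sum_le (c := ∫ z, B z ∂ν) (fun i => integral_nonneg fun z => norm_nonneg _)
    fun s => ?_
  rw [← integral_finsetSum _ fun i _ => (hF i).norm]
  exact integral_mono (integrable_finsetSum _ fun i _ => (hF i).norm) hB (h s)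

/-- An absolutely convergent superposition of rank one operators is of trace class. -/
lemma hasTrace_of_superposition {Z : Type} [MeasurableSpace Z] {ν : Measure Z} [SFinite ν]
    {c : Z → ℂ} (hc : Integrable c ν) {p q : Z → Rn n → ℂ}
    (hp : Measurable (Function.uncurry p)) (hq : Measurable (Function.uncurry q))
    {W : Rn n → ℝ} (hW : MemLp W 2 volume) (hpW : ∀ z x, ‖p z x‖ ≤ W x)
    (hqW : ∀ z x, ‖q z x‖ ≤ W x) {k : 𝓢(Rn n × Rn n, ℂ)}
    (hk : ∀ x y, k (x, y) = ∫ z, c z * (p z x * q z y) ∂ν) {S : L2 n →L[ℂ] L2 n}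
    (hS : IsIntegralOperator k S) : HasTrace S (∫ x, k (x, x)) := by
  intro ι b
  have : Countable ι := countable_of_orthonormal b.orthonormal
  have hpz : ∀ z, Measurable (p z) := fun z => hp.comp (measurable_const.prodMk measurable_id)
  have hqz : ∀ z, Measurable (q z) := fun z => hq.comp (measurable_const.prodMk measurable_id)
  have hU : ∀ z, MemLp (p z) 2 volume := fun z =>
    hW.mono' (hpz z).aestronglyMeasurable (Filter.Eventually.of_forall (hpW z))
  -- The kernel `p(x) q(y)` is the operator `f ↦ ⟪q̄, f⟫ p`; the conjugate compensates for the inner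
  -- product being antilinear in its first slot.
  have hV : ∀ z, MemLp (fun x => star (q z x)) 2 volume := fun z =>
    hW.mono' (continuous_star.measurable.comp (hqz z)).aestronglyMeasurable
      (Filter.Eventually.of_forall fun x => by rw [norm_star]; exact hqW z x)
  set U : Z → L2 n := fun z => (hU z).toLp _
  set V : Z → L2 n := fun z => (hV z).toLp _
  have hUW : ∀ z, ‖U z‖ ≤ ‖hW.toLp W‖ := fun z => by
    apply Lp.norm_le_norm_of_ae_le
    filter_upwards [(hU z).coeFn_toLp, hW.coeFn_toLp] with x h1 h2
    rw [h1, h2]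
    exact (hpW z x).trans (le_abs_self _)
  have hVW : ∀ z, ‖V z‖ ≤ ‖hW.toLp W‖ := fun z => by
    apply Lp.norm_le_norm_of_ae_le
    filter_upwards [(hV z).coeFn_toLp, hW.coeFn_toLp] with x h1 h2
    rw [h1, h2, norm_star]
    exact (hqW z x).trans (le_abs_self _)
  have hα : ∀ (f : L2 n) z, ⟪f, U z⟫_ℂ = ∫ x, p z x * star (f x) := fun f z => by
    rw [L2.inner_def]
    refine integral_congr_ae ?_
    filter_upwards [(hU z).coeFn_toLp] with x h1
    rw [h1]; rfl
  have hβ : ∀ (f : L2 n) z, ⟪V z, f⟫_ℂ = ∫ x, q z x * f x := fun f z => by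
    rw [L2.inner_def]
    refine integral_congr_ae ?_
    filter_upwards [(hV z).coeFn_toLp] with x h1
    rw [h1]
    simp [mul_comm]
  have hVU : ∀ z, ⟪V z, U z⟫_ℂ = ∫ x, p z x * q z x := fun z => by
    rw [hβ]
    refine integral_congr_ae ?_
    filter_upwards [(hU z).coeFn_toLp] with x h1
    rw [h1, mul_comm]
  have hWf : ∀ f : L2 n, Integrable (fun x => W x * ‖f x‖) volume := fun f =>
    hW.integrable_mul (Lp.memLp f).norm
  have hWW : Integrable (fun x => W x * W x) volume := hW.integrable_mul hW
  have hαm : ∀ f : L2 n, AEStronglyMeasurable (fun z => ⟪f, U z⟫_ℂ) ν := fun f => by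
    simp only [hα]
    have : AEStronglyMeasurable (fun w : Z × Rn n => p w.1 w.2 * star (f w.2)) (ν.prod volume) :=
      hp.aestronglyMeasurable.mul
        (continuous_star.comp_aestronglyMeasurable (Lp.memLp f).aestronglyMeasurable.comp_snd)
    exact this.integral_prod_right'
  have hβm : ∀ f : L2 n, AEStronglyMeasurable (fun z => ⟪V z, f⟫_ℂ) ν := fun f => by
    simp only [hβ]
    have : AEStronglyMeasurable (fun w : Z × Rn n => q w.1 w.2 * f w.2) (ν.prod volume) :=
      hq.aestronglyMeasurable.mul (Lp.memLp f).aestronglyMeasurable.comp_snd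
    exact this.integral_prod_right'
  set M := ‖hW.toLp W‖
  have hβb : ∀ (f : L2 n) z, ‖⟪V z, f⟫_ℂ‖ ≤ M * ‖f‖ := fun f z =>
    (norm_inner_le_norm _ _).trans (by gcongr; exact hVW z)
  have hαb : ∀ (f : L2 n) z, ‖⟪f, U z⟫_ℂ‖ ≤ ‖f‖ * M := fun f z =>
    (norm_inner_le_norm _ _).trans (by gcongr; exact hUW z)
  have h1 : ∀ (f : L2 n) x, ∫ y, k (x, y) * f y = ∫ z, c z * ⟪V z, f⟫_ℂ * p z x ∂ν := by
    intro f x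
    have hint : Integrable (Function.uncurry fun y z => c z * (p z x * q z y) * f y)
        ((volume : Measure (Rn n)).prod ν) := by
      refine (((hWf f).const_mul (W x)).mul_prod hc.norm).mono' ?_
        (Filter.Eventually.of_forall fun w => ?_)
      · refine AEStronglyMeasurable.mul (AEStronglyMeasurable.mul hc.aestronglyMeasurable.comp_snd
          ?_) (Lp.memLp f).aestronglyMeasurable.comp_fst
        exact ((hp.comp (measurable_snd.prodMk measurable_const)).mul
          (hq.comp (measurable_snd.prodMk measurable_fst))).aestronglyMeasurable
      · obtain ⟨y, z⟩ := w
        simp only [Function.uncurry, norm_mul]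
        have e1 := hpW z x
        have e2 := hqW z y
        have e0 : 0 ≤ W x := (norm_nonneg _).trans e1
        calc ‖c z‖ * (‖p z x‖ * ‖q z y‖) * ‖f y‖ ≤ ‖c z‖ * (W x * W y) * ‖f y‖ := by gcongr
          _ = _ := by ring
    calc ∫ y, k (x, y) * f y = ∫ y, ∫ z, c z * (p z x * q z y) * f y ∂ν := by
          simp only [hk, integral_mul_const]
      _ = ∫ z, (∫ y, c z * (p z x * q z y) * f y) ∂ν := integral_integral_swap hint
      _ = _ := by
        refine integral_congr_ae (Filter.Eventually.of_forall fun z => ?_)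
        simp only [hβ]
        rw [mul_assoc, ← integral_mul_const, ← integral_const_mul]
        refine integral_congr_ae (Filter.Eventually.of_forall fun y => ?_)
        simp only []
        ring
  have h2 : ∀ f : L2 n, ⟪f, S f⟫_ℂ = ∫ z, c z * (⟪V z, f⟫_ℂ * ⟪f, U z⟫_ℂ) ∂ν := by
    intro f
    have hint : Integrable (Function.uncurry fun x z => c z * ⟪V z, f⟫_ℂ * p z x * star (f x))
        ((volume : Measure (Rn n)).prod ν) := by
      refine (((hWf f).const_mul (M * ‖f‖)).mul_prod hc.norm).mono' ?_
        (Filter.Eventually.of_forall fun w => ?_)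
      · refine AEStronglyMeasurable.mul (AEStronglyMeasurable.mul
          (hc.aestronglyMeasurable.mul (hβm f)).comp_snd ?_)
          (continuous_star.comp_aestronglyMeasurable (Lp.memLp f).aestronglyMeasurable.comp_fst)
        exact (hp.comp (measurable_snd.prodMk measurable_fst)).aestronglyMeasurable
      · obtain ⟨x, z⟩ := w
        simp only [Function.uncurry, norm_mul, norm_star]
        have e1 := hpW z x
        have e2 := hβb f z
        calc ‖c z‖ * ‖⟪V z, f⟫_ℂ‖ * ‖p z x‖ * ‖f x‖ ≤ ‖c z‖ * (M * ‖f‖) * W x * ‖f x‖ := by gcongr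
          _ = _ := by ring
    calc ⟪f, S f⟫_ℂ = ∫ x, ∫ z, c z * ⟪V z, f⟫_ℂ * p z x * star (f x) ∂ν := by
          rw [L2.inner_def]
          refine integral_congr_ae ?_
          filter_upwards [hS f] with x hx
          rw [integral_mul_const, ← h1, ← hx]
          rfl
      _ = ∫ z, (∫ x, c z * ⟪V z, f⟫_ℂ * p z x * star (f x)) ∂ν := integral_integral_swap hint
      _ = _ := by
        refine integral_congr_ae (Filter.Eventually.of_forall fun z => ?_)
        simp only [hα f z]
        rw [← mul_assoc, ← integral_const_mul]
        refine integral_congr_ae (Filter.Eventually.of_forall fun y => ?_)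
        simp only []
        ring
  have h3 : ∫ x, k (x, x) = ∫ z, c z * ⟪V z, U z⟫_ℂ ∂ν := by
    have hint : Integrable (Function.uncurry fun x z => c z * (p z x * q z x))
        ((volume : Measure (Rn n)).prod ν) := by
      refine (hWW.mul_prod hc.norm).mono' ?_ (Filter.Eventually.of_forall fun w => ?_)
      · refine AEStronglyMeasurable.mul hc.aestronglyMeasurable.comp_snd ?_
        exact ((hp.comp (measurable_snd.prodMk measurable_fst)).mul
          (hq.comp (measurable_snd.prodMk measurable_fst))).aestronglyMeasurable
      · obtain ⟨x, z⟩ := w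
        simp only [Function.uncurry, norm_mul]
        have e1 := hpW z x
        have e2 := hqW z x
        have e0 : 0 ≤ W x := (norm_nonneg _).trans e1
        calc ‖c z‖ * (‖p z x‖ * ‖q z x‖) ≤ ‖c z‖ * (W x * W x) := by gcongr
          _ = _ := by ring
    calc ∫ x, k (x, x) = ∫ x, ∫ z, c z * (p z x * q z x) ∂ν := by simp only [hk]
      _ = ∫ z, (∫ x, c z * (p z x * q z x)) ∂ν := integral_integral_swap hint
      _ = _ := by simp only [hVU, integral_const_mul]
  have hint : ∀ i, Integrable (fun z => c z * (⟪V z, b i⟫_ℂ * ⟪b i, U z⟫_ℂ)) ν := by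
    intro i
    refine (hc.norm.mul_const (M * M)).mono' (hc.aestronglyMeasurable.mul
      ((hβm _).mul (hαm _))) (Filter.Eventually.of_forall fun z => ?_)
    have e1 := hβb (b i) z
    have e2 := hαb (b i) z
    rw [b.orthonormal.1 i, mul_one] at e1
    rw [b.orthonormal.1 i, one_mul] at e2
    rw [norm_mul, norm_mul]
    gcongr
  have hsum : Summable fun i => ∫ z, ‖c z * (⟪V z, b i⟫_ℂ * ⟪b i, U z⟫_ℂ)‖ ∂ν := by
    refine summable_integral_of_sum_le hint (hc.norm.mul_const (M ^ 2)) fun s z => ?_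
    simp only [norm_mul]
    rw [← Finset.mul_sum]
    gcongr
    -- Bessel's inequality for both vectors, combined with `ab ≤ (a² + b²)/2`, bounds every finite
    -- partial sum by `M²` uniformly in `z`.
    have e1 := b.orthonormal.sum_inner_products_le (V z) (s := s)
    have e2 := b.orthonormal.sum_inner_products_le (U z) (s := s)
    have e3 : ∑ i ∈ s, ‖⟪V z, b i⟫_ℂ‖ * ‖⟪b i, U z⟫_ℂ‖ ≤
        ∑ i ∈ s, (‖⟪b i, V z⟫_ℂ‖ ^ 2 + ‖⟪b i, U z⟫_ℂ‖ ^ 2) / 2 := by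
      refine Finset.sum_le_sum fun i _ => ?_
      rw [norm_inner_symm (V z)]
      nlinarith [sq_nonneg (‖⟪b i, V z⟫_ℂ‖ - ‖⟪b i, U z⟫_ℂ‖)]
    rw [← Finset.sum_div, Finset.sum_add_distrib] at e3
    have e4 : ‖V z‖ ^ 2 ≤ M ^ 2 := by gcongr; exact hVW z
    have e5 : ‖U z‖ ^ 2 ≤ M ^ 2 := by gcongr; exact hUW z
    linarith
  have h4 := hasSum_integral_of_summable_integral_norm hint hsum
  -- Parseval collapses the sum over the basis to `⟪V z, U z⟫`, so the limit is independent of the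
  -- basis.
  simp only [tsum_mul_left, (b.hasSum_inner_mul_inner _ _).tsum_eq] at h4
  rw [h3]
  simp only [h2]
  exact h4

lemma eq_integral_fourier {V : Type} [NormedAddCommGroup V] [InnerProductSpace ℝ V]
    [MeasurableSpace V] [BorelSpace V] [FiniteDimensional ℝ V] (f : 𝓢(V, ℂ)) (v : V) :
    f v = ∫ ξ, Complex.exp (((2 * Real.pi * ⟪ξ, v⟫_ℝ : ℝ) : ℂ) * Complex.I) •
      FourierTransform.fourier f ξ := by
  rw [← Real.fourierInv_eq', ← SchwartzMap.fourierInv_coe, FourierTransform.fourierInv_fourier_eq]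

variable (n) in
-- Plane waves are not square integrable. Pulling the weight `w` out of both variables of a kernel
-- makes them so, and the compensating factor `g` has temperate growth, so the rest of the kernel
-- stays Schwartz.
lemma exists_schwartz_weight : ∃ w g : Rn n → ℝ, (∀ x, w x * g x = 1) ∧ (∀ x, 0 ≤ w x) ∧
    Continuous w ∧ MemLp w 2 volume ∧
    (fun p : Rn n × Rn n => ((g p.1 * g p.2 : ℝ) : ℂ)).HasTemperateGrowth := by
  let r : ℝ := n + 1
  let w : Rn n → ℝ := fun x => (1 + ‖x‖ ^ 2) ^ (-r)
  let g : Rn n → ℝ := fun x => (1 + ‖x‖ ^ 2) ^ r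
  have hwg : ∀ x, w x * g x = 1 := fun x => by
    have : (0 : ℝ) < 1 + ‖x‖ ^ 2 := by positivity
    simp only [w, g]
    rw [← Real.rpow_add this]; simp
  have hw0 : ∀ x, 0 ≤ w x := fun x => by positivity
  have hw1 : ∀ x, w x ≤ 1 := fun x =>
    Real.rpow_le_one_of_one_le_of_nonpos (by nlinarith [norm_nonneg x]) (by simp only [r]; linarith)
  have hwc : Continuous w := by
    refine Continuous.rpow_const (by fun_prop) fun x => Or.inl ?_
    positivity
  have hwi : Integrable w volume := by
    have h := integrable_rpow_neg_one_add_norm_sq (E := Rn n) (μ := volume) (r := 2 * r)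
      (by simp only [finrank_euclideanSpace_fin, r]; linarith)
    refine h.congr (Filter.Eventually.of_forall fun x => ?_)
    simp only [w]
    congr 1
    ring
  have hw2 : MemLp w 2 volume := by
    rw [memLp_two_iff_integrable_sq hwc.aestronglyMeasurable]
    refine hwi.mono' (hwc.pow 2).aestronglyMeasurable (Filter.Eventually.of_forall fun x => ?_)
    rw [norm_pow, Real.norm_of_nonneg (hw0 x), pow_two]
    exact mul_le_of_le_one_left (hw0 x) (hw1 x)
  have hg : (fun p : Rn n × Rn n => ((g p.1 * g p.2 : ℝ) : ℂ)).HasTemperateGrowth := by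
    have h1 : (fun p : Rn n × Rn n => g p.1).HasTemperateGrowth :=
      (Function.hasTemperateGrowth_one_add_norm_sq_rpow (Rn n) r).comp
        (ContinuousLinearMap.fst ℝ (Rn n) (Rn n)).hasTemperateGrowth
    have h2 : (fun p : Rn n × Rn n => g p.2).HasTemperateGrowth :=
      (Function.hasTemperateGrowth_one_add_norm_sq_rpow (Rn n) r).comp
        (ContinuousLinearMap.snd ℝ (Rn n) (Rn n)).hasTemperateGrowth
    exact Function.HasTemperateGrowth.comp (g := Complex.ofReal) (by fun_prop) (h1.mul h2)
  exact ⟨w, g, hwg, hw0, hwc, hw2, hg⟩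

/-- An integral operator with Schwartz kernel `k` is of trace class with trace `∫ k(x, x) dx`. -/
lemma hasTrace_of_isIntegralOperator {k : 𝓢(Rn n × Rn n, ℂ)} {S : L2 n →L[ℂ] L2 n}
    (hS : IsIntegralOperator k S) : HasTrace S (∫ x, k (x, x)) := by
  obtain ⟨w, g, hwg, hw0, hwc, hw2, hg⟩ := exists_schwartz_weight n
  let h : 𝓢(Rn n × Rn n, ℂ) :=
    SchwartzMap.smulLeftCLM ℂ (fun p : Rn n × Rn n => ((g p.1 * g p.2 : ℝ) : ℂ)) k
  -- The Fourier transform needs an inner product space, so the sup norm on the product is replaced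
  -- by the Euclidean one.
  let H : 𝓢(WithLp 2 (Rn n × Rn n), ℂ) := SchwartzMap.compCLMOfContinuousLinearEquiv ℂ
    (WithLp.prodContinuousLinearEquiv 2 ℝ (Rn n) (Rn n)) h
  let c : 𝓢(WithLp 2 (Rn n × Rn n), ℂ) := FourierTransform.fourier H
  let e : Rn n → Rn n → ℂ := fun ξ x =>
    (w x : ℂ) * Complex.exp (((2 * Real.pi * ⟪ξ, x⟫_ℝ : ℝ) : ℂ) * Complex.I)
  have he : ∀ ξ x, ‖e ξ x‖ ≤ w x := fun ξ x => by
    simp only [e, norm_mul, Complex.norm_exp_ofReal_mul_I, Complex.norm_real, mul_one]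
    rw [Real.norm_of_nonneg (hw0 x)]
  have hec : Continuous (Function.uncurry e) := by
    simp only [e, Function.uncurry_def]
    fun_prop
  refine hasTrace_of_superposition (Z := WithLp 2 (Rn n × Rn n)) (ν := volume)
    (c := c) c.integrable (p := fun z x => e z.fst x) (q := fun z y => e z.snd y) (W := w)
    ?_ ?_ hw2 (fun z x => he z.fst x) (fun z x => he z.snd x) ?_ hS
  · exact Continuous.measurable (hec.comp (by fun_prop :
      Continuous fun w : WithLp 2 (Rn n × Rn n) × Rn n => (w.1.fst, w.2)))
  · exact Continuous.measurable (hec.comp (by fun_prop :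
      Continuous fun w : WithLp 2 (Rn n × Rn n) × Rn n => (w.1.snd, w.2)))
  · intro x y
    have h1 : H (WithLp.toLp 2 (x, y)) = ((g x * g y : ℝ) : ℂ) * k (x, y) := by
      simp only [H, h, SchwartzMap.compCLMOfContinuousLinearEquiv_apply, Function.comp_apply]
      rw [SchwartzMap.smulLeftCLM_apply_apply hg]
      rfl
    have h2 : k (x, y) = ((w x * w y : ℝ) : ℂ) * H (WithLp.toLp 2 (x, y)) := by
      rw [h1, ← mul_assoc, ← Complex.ofReal_mul,
        show w x * w y * (g x * g y) = (w x * g x) * (w y * g y) by ring, hwg, hwg]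
      simp
    rw [h2, eq_integral_fourier H, ← integral_const_mul]
    refine integral_congr_ae (Filter.Eventually.of_forall fun z => ?_)
    have hz : ⟪z, WithLp.toLp 2 (x, y)⟫_ℝ = ⟪z.fst, x⟫_ℝ + ⟪z.snd, y⟫_ℝ :=
      WithLp.prod_inner_apply _ _
    simp only [c, e, smul_eq_mul, hz]
    push_cast
    rw [mul_add, add_mul, Complex.exp_add]
    ring

lemma hasTrace_unique {S : L2 n →L[ℂ] L2 n} {z z' : ℂ} (h : HasTrace S z) (h' : HasTrace S z') :
    z = z' := by
  obtain ⟨w, b, -⟩ := exists_hilbertBasis ℂ (L2 n)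
  exact (h _ b).unique (h' _ b)

lemma opTrace_eq {S : L2 n →L[ℂ] L2 n} {z : ℂ} (h : HasTrace S z) : opTrace S = z := by
  have h1 : ∃ z, HasTrace S z := ⟨z, h⟩
  rw [opTrace, dif_pos h1]
  exact hasTrace_unique h1.choose_spec h

lemma opTrace_eq_integral {k : 𝓢(Rn n × Rn n, ℂ)} {S : L2 n →L[ℂ] L2 n}
    (hS : IsIntegralOperator k S) : opTrace S = ∫ x, k (x, x) :=
  opTrace_eq (hasTrace_of_isIntegralOperator hS)

end SmoothingOps

/-! ### Representation of `K^∞` on Schwartz functions. -/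

namespace SmoothingOps

variable {n : ℕ}

lemma toL2_injective : Function.Injective (toL2 (n := n)) :=
  SchwartzMap.injective_toLp 2 volume

/-- The embedding of Schwartz functions in `L²` as a linear map. -/
noncomputable def toL2Lin (n : ℕ) : 𝓢(Rn n, ℂ) →ₗ[ℂ] L2 n :=
  (SchwartzMap.toLpCLM ℂ ℂ 2 (volume : Measure (Rn n))).toLinearMap

lemma toL2Lin_apply (f : 𝓢(Rn n, ℂ)) : toL2Lin n f = toL2 f := rfl

lemma toL2_denseRange : DenseRange (toL2 (n := n)) :=
  SchwartzMap.denseRange_toLpCLM (F := ℂ) (μ := (volume : Measure (Rn n))) (p := 2)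
    (by norm_num)

lemma exists_toL2_eq (S : smoothing n) (f : 𝓢(Rn n, ℂ)) : ∃ g, toL2 g = S.1 (toL2 f) := by
  obtain ⟨S, k, hk⟩ := S
  exact ⟨kernelAct k f, (hk.apply_toLp f).symm⟩

/-- The action of `K^∞` on Schwartz functions. -/
noncomputable def schwartzFun (S : smoothing n) (f : 𝓢(Rn n, ℂ)) : 𝓢(Rn n, ℂ) :=
  (exists_toL2_eq S f).choose

lemma toL2_schwartzFun (S : smoothing n) (f : 𝓢(Rn n, ℂ)) :
    toL2 (schwartzFun S f) = S.1 (toL2 f) := (exists_toL2_eq S f).choose_spec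

lemma schwartzFun_eq {S : smoothing n} {f g : 𝓢(Rn n, ℂ)} (h : toL2 g = S.1 (toL2 f)) :
    schwartzFun S f = g := toL2_injective ((toL2_schwartzFun S f).trans h.symm)

/-- The representation of `K^∞` on Schwartz functions. -/
noncomputable def schwartzRep (n : ℕ) : smoothing n →ₙₐ[ℂ] Module.End ℂ 𝓢(Rn n, ℂ) where
  toFun S :=
    { toFun := schwartzFun S
      map_add' := fun f g => schwartzFun_eq <| by
        simp only [← toL2Lin_apply, map_add]
        simp only [toL2Lin_apply, toL2_schwartzFun]
      map_smul' := fun c f => schwartzFun_eq <| by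
        simp only [← toL2Lin_apply, map_smul, RingHom.id_apply]
        simp only [toL2Lin_apply, toL2_schwartzFun] }
  map_smul' c S := by
    ext1 f
    refine schwartzFun_eq ?_
    change toL2Lin n (c • schwartzFun S f) = _
    rw [map_smul, toL2Lin_apply, toL2_schwartzFun]
    rfl
  map_zero' := by
    ext1 f
    refine schwartzFun_eq ?_
    change toL2Lin n 0 = _
    rw [map_zero]
    rfl
  map_add' S T := by
    ext1 f
    refine schwartzFun_eq ?_
    change toL2Lin n (schwartzFun S f + schwartzFun T f) = _
    rw [map_add, toL2Lin_apply, toL2_schwartzFun, toL2Lin_apply, toL2_schwartzFun]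
    rfl
  map_mul' S T := by
    ext1 f
    refine schwartzFun_eq ?_
    change toL2 (schwartzFun S (schwartzFun T f)) = _
    rw [toL2_schwartzFun, toL2_schwartzFun]
    rfl

lemma toL2_schwartzRep (S : smoothing n) (f : 𝓢(Rn n, ℂ)) :
    toL2 (schwartzRep n S f) = S.1 (toL2 f) := toL2_schwartzFun S f

lemma schwartzRep_eq {S : smoothing n} {B : Module.End ℂ 𝓢(Rn n, ℂ)}
    (h : ∀ f, toL2 (B f) = S.1 (toL2 f)) : schwartzRep n S = B :=
  LinearMap.ext fun f => schwartzFun_eq (h f)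

lemma schwartzRep_apply_of_kernel {k : 𝓢(Rn n × Rn n, ℂ)} {S : smoothing n}
    (hS : IsIntegralOperator k S.1) (f : 𝓢(Rn n, ℂ)) : schwartzRep n S f = kernelAct k f :=
  schwartzFun_eq (hS.apply_toLp f).symm

/-- Bounded operators are determined on the dense image of Schwartz space. Injectivity is what lets
the trace be transported to the image of the representation. -/
lemma schwartzRep_injective : Function.Injective (schwartzRep n) := by
  intro S T h
  apply Subtype.ext
  have h1 : (S.1 : L2 n → L2 n) = T.1 := by
    refine toL2_denseRange.equalizer S.1.continuous T.1.continuous (funext fun f => ?_)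
    simp only [Function.comp_apply]
    rw [← toL2_schwartzRep, ← toL2_schwartzRep, h]
  exact ContinuousLinearMap.ext fun x => congrFun h1 x

/-- The operator `∂/∂xⱼ` or `xⱼ` on Schwartz functions, in the order of the derivations. -/
noncomputable def weyl (n : ℕ) (i : Fin (2 * n)) : Module.End ℂ 𝓢(Rn n, ℂ) :=
  if (i : ℕ) % 2 = 0 then
    (LineDeriv.lineDerivOpCLM ℂ 𝓢(Rn n, ℂ)
      (EuclideanSpace.single (⟨(i : ℕ) / 2, by omega⟩ : Fin n) (1 : ℝ))).toLinearMap
  else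
    (SchwartzMap.smulLeftCLM ℂ fun x : Rn n =>
      ((x (⟨(i : ℕ) / 2, by omega⟩ : Fin n) : ℝ) : ℂ)).toLinearMap

lemma weyl_even (j : Fin n) (f : 𝓢(Rn n, ℂ)) : weyl n ⟨2 * j, by omega⟩ f = partialD j f := by
  have h : (⟨(2 * (j : ℕ)) / 2, by omega⟩ : Fin n) = j := Fin.ext (by simp)
  simp only [weyl, Nat.mul_mod_right, if_true, h]
  rfl

lemma weyl_odd (j : Fin n) (f : 𝓢(Rn n, ℂ)) : weyl n ⟨2 * j + 1, by omega⟩ f = coordMul j f := by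
  have h : (⟨(2 * (j : ℕ) + 1) / 2, by omega⟩ : Fin n) = j := Fin.ext (by simp; omega)
  have h1 : ¬ (2 * (j : ℕ) + 1) % 2 = 0 := by omega
  simp only [weyl, h1, if_false, h]
  rfl

lemma fin_two_mul_cases {P : Fin (2 * n) → Prop} (h0 : ∀ j : Fin n, P ⟨2 * j, by omega⟩)
    (h1 : ∀ j : Fin n, P ⟨2 * j + 1, by omega⟩) (i : Fin (2 * n)) : P i := by
  rcases Nat.mod_two_eq_zero_or_one i with h | h
  · exact (congrArg P (Fin.ext (show (i : ℕ) = 2 * ((i : ℕ) / 2) by omega))).mpr (h0 ⟨(i : ℕ) / 2, by omega⟩)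
  · exact (congrArg P (Fin.ext (show (i : ℕ) = 2 * ((i : ℕ) / 2) + 1 by omega))).mpr (h1 ⟨(i : ℕ) / 2, by omega⟩)

/-- Turns the commutator condition on `L²` into an honest commutator of endomorphisms of Schwartz
space, where the unbounded operators are everywhere defined. -/
lemma IsCommutator.schwartzRep_eq {B : Module.End ℂ 𝓢(Rn n, ℂ)} {S D : smoothing n}
    (h : IsCommutator B S.1 D.1) :
    schwartzRep n D = B * schwartzRep n S - schwartzRep n S * B := by
  refine SmoothingOps.schwartzRep_eq fun f => ?_
  obtain ⟨g, h1, h2⟩ := h f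
  have hg : schwartzRep n S f = g := schwartzFun_eq h1.symm
  rw [h2, ← toL2_schwartzRep, ← hg]
  exact map_sub (toL2Lin n) _ _

/-- The derivations are the commutators with the operators `∂/∂xⱼ` and `xⱼ`. -/
lemma schwartzRep_delta (i : Fin (2 * n)) (S : smoothing n) :
    schwartzRep n (delta i S) = weyl n i * schwartzRep n S - schwartzRep n S * weyl n i := by
  apply IsCommutator.schwartzRep_eq
  by_cases h : (i : ℕ) % 2 = 0
  · have h1 := (exists_commutator_partialD ⟨(i : ℕ) / 2, by omega⟩ S).choose_spec
    rw [delta, if_pos h, weyl, if_pos h]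
    exact h1
  · have h1 := (exists_commutator_coordMul ⟨(i : ℕ) / 2, by omega⟩ S).choose_spec
    rw [delta, if_neg h, weyl, if_neg h]
    exact h1

/-! ### Kernel calculus and diagonal integrals. -/

section Kernels

variable (k : 𝓢(Rn n × Rn n, ℂ)) (f : 𝓢(Rn n, ℂ)) (j : Fin n)

/-- Multiplication of a kernel by the `j`-th coordinate of the first variable. -/
noncomputable def mulFst : 𝓢(Rn n × Rn n, ℂ) :=
  SchwartzMap.smulLeftCLM ℂ (fun p : Rn n × Rn n => ((p.1 j : ℝ) : ℂ)) k

/-- Multiplication of a kernel by the `j`-th coordinate of the second variable. -/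
noncomputable def mulSnd : 𝓢(Rn n × Rn n, ℂ) :=
  SchwartzMap.smulLeftCLM ℂ (fun p : Rn n × Rn n => ((p.2 j : ℝ) : ℂ)) k

lemma mulFst_apply (x y : Rn n) : mulFst k j (x, y) = (x j : ℂ) * k (x, y) :=
  SchwartzMap.smulLeftCLM_apply_apply ((Complex.ofRealCLM.comp ((EuclideanSpace.proj (𝕜 := ℝ) j).comp
    (ContinuousLinearMap.fst ℝ (Rn n) (Rn n)))).hasTemperateGrowth) k (x, y)

lemma mulSnd_apply (x y : Rn n) : mulSnd k j (x, y) = (y j : ℂ) * k (x, y) :=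
  SchwartzMap.smulLeftCLM_apply_apply ((Complex.ofRealCLM.comp ((EuclideanSpace.proj (𝕜 := ℝ) j).comp
    (ContinuousLinearMap.snd ℝ (Rn n) (Rn n)))).hasTemperateGrowth) k (x, y)

/-- Differentiation of a kernel in the `j`-th coordinate of the first variable. -/
noncomputable def derivFst : 𝓢(Rn n × Rn n, ℂ) :=
  ∂_{((EuclideanSpace.single j (1 : ℝ), 0) : Rn n × Rn n)} k

/-- Differentiation of a kernel in the `j`-th coordinate of the second variable. -/
noncomputable def derivSnd : 𝓢(Rn n × Rn n, ℂ) :=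
  ∂_{((0, EuclideanSpace.single j (1 : ℝ)) : Rn n × Rn n)} k

lemma coordMul_kernelAct : coordMul j (kernelAct k f) = kernelAct (mulFst k j) f := by
  ext x
  simp only [coordMul_apply, kernelAct_apply, mulFst_apply, ← integral_const_mul, mul_assoc]

lemma kernelAct_coordMul : kernelAct k (coordMul j f) = kernelAct (mulSnd k j) f := by
  ext x
  simp only [coordMul_apply, kernelAct_apply, mulSnd_apply]
  refine integral_congr_ae (Filter.Eventually.of_forall fun y => ?_)
  simp only []
  ring

lemma partialD_kernelAct : partialD j (kernelAct k f) = kernelAct (derivFst k j) f := by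
  ext x
  rw [partialD, SchwartzMap.lineDerivOp_apply_eq_fderiv, kernelAct_apply]
  let F := productMap (ContinuousLinearMap.id ℝ (Rn n × Rn n))
    (ContinuousLinearMap.snd ℝ (Rn n) (Rn n)) (fun _ => le_max_left _ _) k f
  have hd : fderiv ℝ (kernelAct k f) x = ∫ y, partialFDeriv F (x, y) :=
    (hasFDerivAt_partialIntegral volume F x).fderiv
  rw [hd, ContinuousLinearMap.integral_apply (integrable_schwartz_slice volume _ x)]
  refine integral_congr_ae (Filter.Eventually.of_forall fun y => ?_)
  have ha : HasFDerivAt (fun x => k (x, y) * f y) _ x :=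
    (hasFDerivAt_partial k x y).mul_const (f y)
  have hb : HasFDerivAt (fun x => k (x, y) * f y) (partialFDeriv F (x, y)) x :=
    hasFDerivAt_partial F x y
  simp only []
  rw [hb.unique ha, derivFst, SchwartzMap.lineDerivOp_apply_eq_fderiv]
  simp [partialFDeriv_apply, mul_comm]

lemma kernelAct_partialD : kernelAct k (partialD j f) = kernelAct (-derivSnd k j) f := by
  ext x
  have hd2 : ∀ y, HasFDerivAt (fun y => k (x, y))
      ((fderiv ℝ k (x, y)).comp (ContinuousLinearMap.inr ℝ (Rn n) (Rn n))) y := fun y =>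
    HasFDerivAt.comp (f := fun e => (x, e)) y (k.hasFDerivAt (x, y)) (hasFDerivAt_prodMk_right x y)
  have hk2 : ∀ y, derivSnd k j (x, y) =
      fderiv ℝ (fun y => k (x, y)) y (EuclideanSpace.single j 1) := by
    intro y
    rw [(hd2 y).fderiv, derivSnd, SchwartzMap.lineDerivOp_apply_eq_fderiv]
    simp
  have hf2 : ∀ y, partialD j f y = fderiv ℝ f y (EuclideanSpace.single j 1) := fun y => by
    rw [partialD, SchwartzMap.lineDerivOp_apply_eq_fderiv]
  have i1 := kernelAct_integrable (derivSnd k j) f x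
  have i2 := kernelAct_integrable k (partialD j f) x
  simp only [kernelAct_apply, neg_apply, neg_mul, integral_neg]
  simp only [hk2] at i1 ⊢
  simp only [hf2] at i2 ⊢
  exact integral_mul_fderiv_eq_neg_fderiv_mul_of_integrable i1 i2 (kernelAct_integrable k f x)
    (fun y _ => (hd2 y).differentiableAt) (fun y _ => f.differentiableAt)

lemma integrable_diagonal : Integrable (fun x => k (x, x)) volume := by
  obtain ⟨C, hC0, hC⟩ := kernel_bound k
  refine ((weight_integrable (n := n)).const_mul C).mono'
    (k.continuous.comp (by fun_prop)).aestronglyMeasurable (Filter.Eventually.of_forall fun x => ?_)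
  refine (hC x x).trans ?_
  exact mul_le_of_le_one_right (mul_nonneg hC0 (weight_nonneg x)) (weight_le_one _ x)

/-- The two partial derivatives add up to the derivative of `x ↦ k(x, x)`, which integrates to zero:
integration by parts against the constant `1`. -/
lemma integral_diagonal_deriv :
    ∫ x, derivFst k j (x, x) = ∫ x, (-derivSnd k j) (x, x) := by
  have hd : ∀ x, HasFDerivAt (fun x : Rn n => k (x, x)) ((fderiv ℝ k (x, x)).comp
      ((ContinuousLinearMap.id ℝ (Rn n)).prod (ContinuousLinearMap.id ℝ (Rn n)))) x := fun x =>
    HasFDerivAt.comp (f := fun x : Rn n => (x, x)) x (k.hasFDerivAt (x, x))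
      ((hasFDerivAt_id x).prodMk (hasFDerivAt_id x))
  have hk : ∀ x, derivFst k j (x, x) + derivSnd k j (x, x) =
      fderiv ℝ (fun x : Rn n => k (x, x)) x (EuclideanSpace.single j 1) := fun x => by
    rw [(hd x).fderiv, derivFst, derivSnd, SchwartzMap.lineDerivOp_apply_eq_fderiv,
      SchwartzMap.lineDerivOp_apply_eq_fderiv, ← map_add]
    simp
  have hi := (integrable_diagonal (derivFst k j)).add (integrable_diagonal (derivSnd k j))
  have h1 := integral_mul_fderiv_eq_neg_fderiv_mul_of_integrable (𝕜 := ℂ)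
    (μ := (volume : Measure (Rn n))) (f := fun _ => (1 : ℂ)) (g := fun x : Rn n => k (x, x))
    (v := EuclideanSpace.single j 1) (by simp) (by
      simp only [← hk, one_mul]; exact hi) (by simpa using integrable_diagonal k)
      (by fun_prop) (fun x _ => (hd x).differentiableAt)
  simp only [← hk, one_mul] at h1
  rw [integral_add (integrable_diagonal _) (integrable_diagonal _)] at h1
  simp only [neg_apply, integral_neg]
  simp only [fderiv_fun_const, Pi.zero_apply, zero_apply, zero_mul, integral_zero, neg_zero] at h1
  exact eq_neg_of_add_eq_zero_left h1

lemma integral_diagonal_kernelComp (l : 𝓢(Rn n × Rn n, ℂ)) :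
    ∫ x, kernelComp k l (x, x) = ∫ x, kernelComp l k (x, x) := by
  simp only [kernelComp_apply]
  rw [integral_integral_swap]
  · simp only [mul_comm]
  · obtain ⟨C, hC0, hC⟩ := kernel_bound k
    obtain ⟨C', hC'0, hC'⟩ := kernel_bound l
    refine ((weight_integrable.const_mul (C * C')).mul_prod weight_integrable).mono' ?_
      (Filter.Eventually.of_forall fun p => ?_)
    · exact ((k.continuous.comp continuous_id).mul
        (l.continuous.comp continuous_swap)).aestronglyMeasurable
    · obtain ⟨x, z⟩ := p
      simp only [Function.uncurry, norm_mul]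
      have hx := weight_nonneg x
      have hz := weight_nonneg z
      have hx1 : weight x ≤ 1 := weight_le_one _ x
      have hz1 : weight z ≤ 1 := weight_le_one _ z
      calc ‖k (x, z)‖ * ‖l (z, x)‖ ≤ (C * weight x * weight z) * (C' * 1 * 1) := by
            gcongr
            · exact hC x z
            · exact (hC' z x).trans (by gcongr)
        _ = _ := by ring

end Kernels

/-- For every kernel operator, the products with `∂/∂xⱼ` or `xⱼ` have kernels with equal
diagonal integrals. -/
lemma exists_weyl_mul (i : Fin (2 * n)) (S : smoothing n) : ∃ P Q : smoothing n,
    weyl n i * schwartzRep n S = schwartzRep n P ∧ schwartzRep n S * weyl n i = schwartzRep n Q ∧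
    opTrace P.1 = opTrace Q.1 := by
  obtain ⟨k, hk⟩ := S.2
  have key : ∀ (l r : 𝓢(Rn n × Rn n, ℂ)),
      (∀ f, weyl n i (kernelAct k f) = kernelAct l f) →
      (∀ f, kernelAct k (weyl n i f) = kernelAct r f) →
      ∫ x, l (x, x) = ∫ x, r (x, x) → ∃ P Q : smoothing n,
        weyl n i * schwartzRep n S = schwartzRep n P ∧
        schwartzRep n S * weyl n i = schwartzRep n Q ∧ opTrace P.1 = opTrace Q.1 := by
    intro l r hl hr hlr
    obtain ⟨P, hP⟩ := exists_integralOperator l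
    obtain ⟨Q, hQ⟩ := exists_integralOperator r
    refine ⟨⟨P, l, hP⟩, ⟨Q, r, hQ⟩, LinearMap.ext fun f => ?_, LinearMap.ext fun f => ?_, ?_⟩
    · rw [Module.End.mul_apply, schwartzRep_apply_of_kernel hk, hl]
      exact (schwartzRep_apply_of_kernel (S := ⟨P, l, hP⟩) hP f).symm
    · rw [Module.End.mul_apply, schwartzRep_apply_of_kernel hk, hr]
      exact (schwartzRep_apply_of_kernel (S := ⟨Q, r, hQ⟩) hQ f).symm
    · rw [opTrace_eq_integral hP, opTrace_eq_integral hQ, hlr]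
  induction i using fin_two_mul_cases with
  | h0 j =>
    simp only [weyl_even] at key
    exact key _ _ (fun f => partialD_kernelAct k f j) (fun f => kernelAct_partialD k f j)
      (integral_diagonal_deriv k j)
  | h1 j =>
    simp only [weyl_odd] at key
    exact key _ _ (fun f => coordMul_kernelAct k f j) (fun f => kernelAct_coordMul k f j)
      (by simp only [mulFst_apply, mulSnd_apply])

lemma hasTrace_opTrace (S : smoothing n) : HasTrace S.1 (opTrace S.1) := by
  obtain ⟨k, hk⟩ := S.2
  rw [opTrace_eq_integral hk]
  exact hasTrace_of_isIntegralOperator hk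

/-- The trace on `K^∞` as a linear functional. -/
noncomputable def trLin (n : ℕ) : smoothing n →ₗ[ℂ] ℂ where
  toFun S := opTrace S.1
  map_add' S T := opTrace_eq fun ι b => by
    simpa [inner_add_right] using (hasTrace_opTrace S ι b).add (hasTrace_opTrace T ι b)
  map_smul' c S := opTrace_eq fun ι b => by
    simpa [inner_smul_right] using (hasTrace_opTrace S ι b).mul_left c

lemma trLin_apply (S : smoothing n) : trLin n S = opTrace S.1 := rfl

lemma trLin_mul_comm (S T : smoothing n) : trLin n (S * T) = trLin n (T * S) := by
  obtain ⟨k, hk⟩ := S.2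
  obtain ⟨l, hl⟩ := T.2
  rw [trLin_apply, trLin_apply]
  have h1 : IsIntegralOperator (kernelComp k l) (S * T).1 := isIntegralOperator_mul hk hl
  have h2 : IsIntegralOperator (kernelComp l k) (T * S).1 := isIntegralOperator_mul hl hk
  rw [opTrace_eq_integral h1, opTrace_eq_integral h2, integral_diagonal_kernelComp]

/-- `HeisenbergTrace` asks for a functional on the whole endomorphism algebra. Any algebraic
extension will do, since its axioms only evaluate the functional on the image of `K^∞`. -/
lemma exists_trace_extension (n : ℕ) : ∃ τ : Module.End ℂ 𝓢(Rn n, ℂ) →ₗ[ℂ] ℂ,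
    ∀ S, τ (schwartzRep n S) = trLin n S := by
  obtain ⟨g, hg⟩ := LinearMap.exists_leftInverse_of_injective
    ({ toFun := schwartzRep n, map_add' := map_add _, map_smul' := map_smul _ } :
      smoothing n →ₗ[ℂ] Module.End ℂ 𝓢(Rn n, ℂ))
    (LinearMap.ker_eq_bot.2 schwartzRep_injective)
  exact ⟨trLin n ∘ₗ g, fun S => congrArg (trLin n) (LinearMap.congr_fun hg S)⟩

lemma partialD_comm (i j : Fin n) (f : 𝓢(Rn n, ℂ)) :
    partialD i (partialD j f) = partialD j (partialD i f) := by
  ext x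
  have h : ∀ u v : Rn n, ∂_{u} (∂_{v} f) x = fderiv ℝ (fderiv ℝ f) x u v := by
    intro u v
    rw [SchwartzMap.lineDerivOp_apply_eq_fderiv]
    have h1 : ((∂_{v} f : 𝓢(Rn n, ℂ)) : Rn n → ℂ) = fun y => fderiv ℝ f y v := rfl
    have h2 : DifferentiableAt ℝ (fderiv ℝ f) x :=
      (SchwartzMap.fderivCLM ℝ (Rn n) ℂ f).differentiableAt
    rw [h1, fderiv_clm_apply h2 (differentiableAt_const v)]
    simp
  rw [partialD, partialD, partialD, partialD, h, h]
  exact ((f.smooth 2).contDiffAt.isSymmSndFDerivAt (by simp)).eq _ _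

lemma coordMul_comm (i j : Fin n) (f : 𝓢(Rn n, ℂ)) :
    coordMul i (coordMul j f) = coordMul j (coordMul i f) := by
  ext x
  simp only [coordMul_apply]
  ring

lemma partialD_coordMul (i j : Fin n) (f : 𝓢(Rn n, ℂ)) :
    partialD i (coordMul j f) = coordMul j (partialD i f) + if i = j then f else 0 := by
  ext x
  have h1 : (coordMul j f : Rn n → ℂ) = fun y => ((y j : ℝ) : ℂ) * f y :=
    funext (coordMul_apply j f)
  have h2 : HasFDerivAt (fun y : Rn n => ((y j : ℝ) : ℂ))
      (Complex.ofRealCLM.comp (EuclideanSpace.proj (𝕜 := ℝ) j)) x :=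
    (Complex.ofRealCLM.comp (EuclideanSpace.proj (𝕜 := ℝ) j)).hasFDerivAt
  have h3 : HasFDerivAt (fun y : Rn n => ((y j : ℝ) : ℂ) * f y) _ x := h2.mul (f.hasFDerivAt x)
  rw [partialD, SchwartzMap.lineDerivOp_apply_eq_fderiv, h1, h3.fderiv]
  change _ = coordMul j (partialD i f) x + (if i = j then f else 0 : 𝓢(Rn n, ℂ)) x
  rw [coordMul_apply, partialD, SchwartzMap.lineDerivOp_apply_eq_fderiv]
  by_cases h : i = j
  · subst h
    simp
  · simp [h, Ne.symm h]

end SmoothingOps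

/-! ### The Heisenberg relations and the cocycle `ω`. -/

namespace SmoothingOps

variable {n : ℕ}

/-- The structure constants of the Heisenberg commutation relations. -/
noncomputable def heisenbergForm (n : ℕ) (a b : Fin (2 * n)) : ℂ :=
  if (a : ℕ) / 2 = b / 2 then
    if (a : ℕ) % 2 = 0 then (if (b : ℕ) % 2 = 0 then 0 else 1)
    else (if (b : ℕ) % 2 = 0 then -1 else 0)
  else 0

lemma heisenbergForm_even_even (i j : Fin n) :
    heisenbergForm n ⟨2 * i, by omega⟩ ⟨2 * j, by omega⟩ = 0 := by
  simp [heisenbergForm]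

lemma heisenbergForm_odd_odd (i j : Fin n) :
    heisenbergForm n ⟨2 * i + 1, by omega⟩ ⟨2 * j + 1, by omega⟩ = 0 := by
  simp [heisenbergForm, Nat.add_mod]

lemma heisenbergForm_even_odd (i j : Fin n) :
    heisenbergForm n ⟨2 * i, by omega⟩ ⟨2 * j + 1, by omega⟩ = if i = j then 1 else 0 := by
  have h : (i : ℕ) = (2 * (j : ℕ) + 1) / 2 ↔ i = j := by rw [Fin.ext_iff]; omega
  simp [heisenbergForm, Nat.add_mod, h]

lemma heisenbergForm_odd_even (i j : Fin n) :
    heisenbergForm n ⟨2 * i + 1, by omega⟩ ⟨2 * j, by omega⟩ = if i = j then -1 else 0 := by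
  have h : (2 * (i : ℕ) + 1) / 2 = (j : ℕ) ↔ i = j := by rw [Fin.ext_iff]; omega
  simp [heisenbergForm, Nat.add_mod, h]

lemma weyl_comm (a b : Fin (2 * n)) : weyl n a * weyl n b - weyl n b * weyl n a =
    algebraMap ℂ (Module.End ℂ 𝓢(Rn n, ℂ)) (heisenbergForm n a b) := by
  refine LinearMap.ext fun f => ?_
  simp only [LinearMap.sub_apply, Module.End.mul_apply, Module.algebraMap_end_apply]
  induction a using fin_two_mul_cases with
  | h0 i =>
    induction b using fin_two_mul_cases with
    | h0 j => simp only [weyl_even, partialD_comm i j, sub_self, heisenbergForm_even_even, zero_smul]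
    | h1 j =>
      simp only [weyl_even, weyl_odd, partialD_coordMul, heisenbergForm_even_odd]
      split_ifs <;> simp
  | h1 i =>
    induction b using fin_two_mul_cases with
    | h0 j =>
      simp only [weyl_even, weyl_odd, partialD_coordMul, heisenbergForm_odd_even, eq_comm (a := j)]
      split_ifs <;> simp
    | h1 j => simp only [weyl_odd, coordMul_comm i j, sub_self, heisenbergForm_odd_odd, zero_smul]

/-- The algebra `K^∞` with its trace and the operators `∂/∂xⱼ`, `xⱼ`. -/
noncomputable def heisenbergTrace (n : ℕ) :
    HeisenbergTrace (2 * n) (smoothing n) (Module.End ℂ 𝓢(Rn n, ℂ)) where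
  ρ := schwartzRep n
  X := weyl n
  c := heisenbergForm n
  comm := weyl_comm
  left_mem a S := by
    obtain ⟨P, Q, h, -⟩ := exists_weyl_mul a S
    exact ⟨P, h⟩
  right_mem a S := by
    obtain ⟨P, Q, -, h, -⟩ := exists_weyl_mul a S
    exact ⟨Q, h⟩
  τ := (exists_trace_extension n).choose
  trace_mul S T := by
    rw [← map_mul, ← map_mul, (exists_trace_extension n).choose_spec,
      (exists_trace_extension n).choose_spec, trLin_mul_comm]
  trace_comm a S := by
    obtain ⟨P, Q, h1, h2, h3⟩ := exists_weyl_mul a S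
    rw [h1, h2, (exists_trace_extension n).choose_spec, (exists_trace_extension n).choose_spec]
    exact h3

lemma heisenbergTrace_τ (S : smoothing n) :
    (heisenbergTrace n).τ (schwartzRep n S) = opTrace S.1 :=
  (exists_trace_extension n).choose_spec S

lemma heisenbergTrace_curv : (heisenbergTrace n).curv = symplectic n :=
  HeisenbergTrace.curv_eq_symplectic _ heisenbergForm_even_even heisenbergForm_odd_odd
    heisenbergForm_even_odd heisenbergForm_odd_even

/-- `K^∞` has no unit in general, so an empty product is not available in it; the leading factor `S`
keeps the product inside the algebra. -/
lemma exists_mul_list_prod (l : List (smoothing n)) (S : smoothing n) : ∃ P : smoothing n,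
    P.1 = S.1 * (l.map Subtype.val).prod ∧
    schwartzRep n P = schwartzRep n S * (l.map (schwartzRep n)).prod := by
  induction l generalizing S with
  | nil => exact ⟨S, by simp, by simp⟩
  | cons T l ih =>
    obtain ⟨P, h1, h2⟩ := ih (S * T)
    exact ⟨P, by simpa [mul_assoc] using h1, by simpa [mul_assoc] using h2⟩

/-- One element of `K^∞` realizes the product both on `L²`, where the trace is defined, and on
Schwartz space, where the cycle lives. It also shows that the traces in `ω` exist. -/
lemma exists_omegaProduct (σ : Equiv.Perm (Fin (2 * n))) (T : Fin (2 * n + 1) → smoothing n) :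
    ∃ P : smoothing n, P.1 = omegaProduct σ T ∧
    schwartzRep n P = schwartzRep n (T 0) * (List.ofFn fun i : Fin (2 * n) =>
      weyl n (σ i) * schwartzRep n (T i.succ) - schwartzRep n (T i.succ) * weyl n (σ i)).prod := by
  obtain ⟨P, h1, h2⟩ := exists_mul_list_prod (List.ofFn fun i => delta (σ i) (T i.succ)) (T 0)
  refine ⟨P, by rw [h1, List.map_ofFn]; rfl, ?_⟩
  rw [h2, List.map_ofFn]
  congr 3
  funext i
  exact schwartzRep_delta _ _

/-- The cocycle `ω`. -/
noncomputable def omegaCocycle (n : ℕ) : cocycles (smoothing n) (2 * n) :=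
  ((-1) ^ n / (n.factorial : ℂ)) • (heisenbergTrace n).cycle.cocycle (2 * n) (even_two_mul n)

lemma omegaCocycle_val : (omegaCocycle n).1 =
    ((-1) ^ n / (n.factorial : ℂ)) • (heisenbergTrace n).cycle.character (2 * n) := rfl

lemma omegaCocycle_apply (T : Fin (2 * n + 1) → smoothing n) :
    (omegaCocycle n).1 T = omega T := by
  rw [omegaCocycle_val, smul_apply, HeisenbergTrace.character_eq, omega, smul_eq_mul]
  congr 1
  refine Finset.sum_congr rfl fun σ _ => ?_
  obtain ⟨P, h1, h2⟩ := exists_omegaProduct σ T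
  rw [← h1, ← heisenbergTrace_τ, h2]
  rfl

/-- The value of `ω # tr` on an idempotent matrix is the trace of the matrix. -/
lemma cupTr_omegaCocycle {k : ℕ} {e : Matrix (Fin k) (Fin k) (smoothing n)}
    (he : IsIdempotentElem e) :
    (cupTr (omegaCocycle n).1 fun _ => e) = ∑ i, opTrace (e i i).1 := by
  have h1 : (cupTr (omegaCocycle n).1 fun _ => e) = (-1) ^ n / (n.factorial : ℂ) *
      cupTr ((heisenbergTrace n).cycle.character (2 * n)) fun _ => e := by
    rw [omegaCocycle_val, cupTr, cupTr, Finset.mul_sum]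
    rfl
  -- The sign in the normalization of `ω` cancels the sign produced by replacing each curvature
  -- factor by `-D² e`.
  have h2 : ((-1 : ℂ) ^ n) * (-1) ^ n = 1 := by rw [← mul_pow]; simp
  have h3 : (n.factorial : ℂ) ≠ 0 := Nat.cast_ne_zero.2 n.factorial_ne_zero
  rw [h1, HeisenbergTrace.cupTr_character, HeisenbergTrace.character_idempotent _ he,
    HeisenbergTrace.matrix_curv, heisenbergTrace_curv, berezin_symplectic_pow,
    HeisenbergTrace.matrix_τ]
  have h4 : ∑ i, (heisenbergTrace n).τ ((heisenbergTrace n).ρ (e i i)) =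
      ∑ i, opTrace (e i i).1 := Finset.sum_congr rfl fun i _ => heisenbergTrace_τ _
  rw [h4]
  field_simp
  linear_combination (∑ i, opTrace (e i i).1) * h2

end SmoothingOps

theorem proposition5p1 (n : ℕ) :
    -- all traces in the definition of `ω` exist
    (∀ (T : Fin (2 * n + 1) → smoothing n) (σ : Equiv.Perm (Fin (2 * n))),
      ∃ z, HasTrace (omegaProduct σ T) z) ∧
    -- `ω` is a cyclic `2n`-cocycle on `K^∞`
    ∃ Ω : cocycles (smoothing n) (2 * n), (∀ T, Ω.1 T = omega T) ∧
      -- its class, suitably normalized, pairs with the `K₀`-class of any idempotent to the trace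
      ∀ T : smoothing n, IsIdempotentElem T →
        (∃ z, HasTrace (T : L2 n →L[ℂ] L2 n) z) ∧
        ∀ φ : cocycles (smoothing n) (2 * n),
          HC.mk φ = HC.mk (((2 * Real.pi * Complex.I) ^ n * (n.factorial : ℂ)) • Ω) →
          ∀ (k : ℕ) (e : Matrix (Fin k) (Fin k) (smoothing n)), IsIdempotentElem e →
            SameK0Class e (Matrix.of fun _ _ : Fin 1 => T) →
            pairing e φ = opTrace (T : L2 n →L[ℂ] L2 n) := by
  refine ⟨fun T σ => ?_, omegaCocycle n, omegaCocycle_apply, fun T _ => ⟨⟨_, hasTrace_opTrace T⟩,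
    fun φ hφ k e he heT => ?_⟩⟩
  · obtain ⟨P, h, -⟩ := exists_omegaProduct σ T
    exact ⟨_, h ▸ hasTrace_opTrace P⟩
  · have h1 := cupTr_eq_of_HC_eq hφ he
    have h2 : (cupTr (((2 * Real.pi * Complex.I) ^ n * (n.factorial : ℂ)) • omegaCocycle n).1
        fun _ => e) = (2 * Real.pi * Complex.I) ^ n * (n.factorial : ℂ) *
        cupTr (omegaCocycle n).1 fun _ => e := by
      rw [cupTr, cupTr, Finset.mul_sum]
      rfl
    -- Invariance under `K₀` is needed only for the trace, because the pairing with any idempotent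
    -- matrix has already been identified with its trace.
    have h3 := trace_eq_of_sameK0Class heT (trLin n) trLin_mul_comm
    simp only [trLin_apply, Matrix.of_apply, Finset.univ_unique, Finset.sum_const,
      Finset.card_singleton, one_smul] at h3
    have h4 : (2 * Real.pi * Complex.I) ^ n ≠ 0 := pow_ne_zero _ Complex.two_pi_I_ne_zero
    have h5 : (n.factorial : ℂ) ≠ 0 := Nat.cast_ne_zero.2 n.factorial_ne_zero
    rw [pairing, h1, h2, cupTr_omegaCocycle he, h3]
    field_simp
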